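/- Let $n\ge 0$ and consider a chain of qubits $1,\dots,n$. For real parameters $\vec\theta=(\theta_{1,j},\theta_{2,j},\theta_{3,j})$ let $$U(\vec\theta)=\prod_{j}e^{i\theta_{1,j}\mathrm{SWAP}_{2j+1,2j+2}}\ \prod_{j}e^{i\theta_{2,j}\mathrm{SWAP}_{2j,2j+1}}\ \prod_{j}e^{i\theta_{3,j}\mathrm{SWAP}_{2j+1,2j+2}},$$ where each product runs over all $j$ for which both qubits of the pair lie in $\{1,\dots,n\}$ (open chain). For $S\subseteq\{0,1,\dots,\lfloor n/4\rfloor-1\}$ let $$U_S=\prod_{j\in S}\mathrm{SWAP}_{4j+1,\,4j+4},$$ so that $U_S$ swaps the first and last qubits of the four-qubit block $\{4j+1,\dots,4j+4\}$ for every $j\in S$. Let $\mathrm{stab}_1=\{|0\rangle,|1\rangle,|+\rangle,|-\rangle,|y+\rangle,|y-\rangle\}$, and define the local cost function $$C_S(\vec\theta)=\mathop{\mathbb E}_{|\psi\rangle=\bigotimes_{i=1}^n|\psi_i\rangle}\ \sum_{i=1}^n\Bigl(1-\mathrm{Tr}\bigl(\langle\psi_i|\,U(\vec\theta)^\dagger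 U_S|\psi\rangle\langle\psi|U_S^\dagger U(\vec\theta)\,|\psi_i\rangle\bigr)\Bigr),$$ where the $|\psi_i\rangle$ are independent and uniform in $\mathrm{stab}_1$, $\langle\psi_i|\cdot|\psi_i\rangle$ is the partial inner product on qubit $i$, and the trace is over the other $n-1$ qubits. **Proposition (exponentially many strictly suboptimal local minima).** For every $n$ and every $S\subseteq\{0,\dots,\lfloor n/4\rfloor-1\}$, the function $C_S$ attains its minimum, and there are $2^{|S|}-1$ parameter vectors $\vec\theta_x$, $x=0,\dots,2^{|S|}-2$, whose circuits $U(\vec\theta_x)$ are pairwise distinct, even up to a scalar factor, such that for every $x$ $$C_S(\vec\theta_x)\ \ge\ 1+\min_{\vec\theta}C_S(\vec\theta)\qquad\text{(strictly suboptimal)},$$ $$C_S(\vec\theta_x)\ \le\ C_S(\vec\theta)\quad\text{for all }\vec\theta\text{ with }\|\vec\theta-\vec\theta_x\|_\infty<\pi/4\qquad\text{(local minimum)}.$$ In particular, when $|S|=\Theta(n)$ the number of these local minima is exponential in $n$. -/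

import Mathlib

open scoped BigOperators Matrix

noncomputable section

namespace SwapAnsatz

/-- Computational basis labels of `n` qubits. The qubits `1, …, n` of a chain are numbered
`0, …, n - 1` here. -/
abbrev Basis (n : ℕ) : Type := Fin n → Fin 2

/-- Operators on `(ℂ²)^{⊗ n}`, as matrices in the computational basis. -/
abbrev Op (n : ℕ) : Type := Matrix (Basis n) (Basis n) ℂ

/-- The operator that exchanges the states of the qubits `a` and `b`. -/
def swap {n : ℕ} (a b : Fin n) : Op n :=
  Matrix.of fun x y => if x = y ∘ Equiv.swap a b then 1 else 0

/-- The gate `exp(i t SWAP_{a,b})` (matrix exponential). -/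
def swapRot {n : ℕ} (t : ℝ) (a b : Fin n) : Op n :=
  NormedSpace.exp ((Complex.I * (t : ℂ)) • swap a b)

/-- The gates of the open-chain three-layer circuit on `n` qubits: the first and the third layer
have one gate for each pair `(2j, 2j+1)` with `2j+1 < n`, and the second layer has one gate for
each pair `(2j+1, 2j+2)` with `2j+2 < n` (qubits numbered from `0`). -/
abbrev GateIndex (n : ℕ) : Type := Fin (n / 2) ⊕ Fin ((n - 1) / 2) ⊕ Fin (n / 2)

/-- Parameter vectors; the norm is the supremum norm. -/
abbrev Params (n : ℕ) : Type := GateIndex n → ℝ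

/-- The layer `∏_j exp(i t_j SWAP)` on the pairs `(2j, 2j+1)`. The factors act on disjoint pairs
of qubits, so they commute. -/
def evenLayer (n : ℕ) (t : Fin (n / 2) → ℝ) : Op n :=
  (List.ofFn fun j : Fin (n / 2) =>
    swapRot (t j) (⟨2 * j.val, by omega⟩ : Fin n) ⟨2 * j.val + 1, by omega⟩).prod

/-- The layer `∏_j exp(i t_j SWAP)` on the pairs `(2j+1, 2j+2)`. The factors act on disjoint pairs
of qubits, so they commute. -/
def oddLayer (n : ℕ) (t : Fin ((n - 1) / 2) → ℝ) : Op n :=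
  (List.ofFn fun j : Fin ((n - 1) / 2) =>
    swapRot (t j) (⟨2 * j.val + 1, by omega⟩ : Fin n) ⟨2 * j.val + 2, by omega⟩).prod

/-- The ansatz `U(θ)`. -/
def circuit {n : ℕ} (θ : Params n) : Op n :=
  evenLayer n (fun j => θ (Sum.inl j)) *
    oddLayer n (fun j => θ (Sum.inr (Sum.inl j))) *
    evenLayer n (fun j => θ (Sum.inr (Sum.inr j)))

/-- The target `U_S`: for each `j ∈ S`, the first and the last qubit of the `j`-th block of four
consecutive qubits are exchanged. The blocks are disjoint, so the factors commute. -/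
def target {n : ℕ} (S : Finset (Fin (n / 4))) : Op n :=
  ((S.sort (· ≤ ·)).map fun j : Fin (n / 4) =>
    swap (⟨4 * j.val, by omega⟩ : Fin n) ⟨4 * j.val + 3, by omega⟩).prod

/-- The six single-qubit stabilizer states `|0⟩, |1⟩, |+⟩, |-⟩, |y+⟩, |y-⟩`. -/
def stab : Fin 6 → Fin 2 → ℂ :=
  ![![1, 0],
    ![0, 1],
    ![1 / (Real.sqrt 2 : ℂ), 1 / (Real.sqrt 2 : ℂ)],
    ![1 / (Real.sqrt 2 : ℂ), -1 / (Real.sqrt 2 : ℂ)],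
    ![1 / (Real.sqrt 2 : ℂ), Complex.I / (Real.sqrt 2 : ℂ)],
    ![1 / (Real.sqrt 2 : ℂ), -Complex.I / (Real.sqrt 2 : ℂ)]]

/-- The product stabilizer state `⊗_i |ψ_i⟩` with `ψ_i = stab (s i)`. -/
def prodState {n : ℕ} (s : Fin n → Fin 6) : Basis n → ℂ :=
  fun x => ∏ i, stab (s i) (x i)

/-- The operator `⟨φ| M |φ⟩` on the qubits other than `i`, where `φ` is a state of qubit `i`. -/
def partialBraket {n : ℕ} (i : Fin n) (φ : Fin 2 → ℂ) (M : Op n) :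
    Matrix ({k : Fin n // k ≠ i} → Fin 2) ({k : Fin n // k ≠ i} → Fin 2) ℂ :=
  Matrix.of fun x y => ∑ a : Fin 2, ∑ b : Fin 2,
    star (φ a) * M ((Equiv.funSplitAt i (Fin 2)).symm (a, x))
      ((Equiv.funSplitAt i (Fin 2)).symm (b, y)) * φ b

/-- The local cost `C_S(θ)`: the average over uniformly random product stabilizer states `ψ` of
`∑_i (1 - Tr ⟨ψ_i| U(θ)† U_S |ψ⟩⟨ψ| U_S† U(θ) |ψ_i⟩)`. The trace is that of a positive
semidefinite operator, so it is a real number. -/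
def cost {n : ℕ} (S : Finset (Fin (n / 4))) (θ : Params n) : ℝ :=
  (1 / 6 ^ n : ℝ) * ∑ s : Fin n → Fin 6, ∑ i : Fin n,
    (1 - (Matrix.trace (partialBraket i (stab (s i))
      ((circuit θ)ᴴ * target S *
        Matrix.vecMulVec (prodState s) (star (prodState s)) *
        (target S)ᴴ * circuit θ))).re)

end SwapAnsatz

end

open scoped BigOperators Matrix

noncomputable section

namespace SwapAnsatz

/-! A stabilizer projector is (1 + A)/2 with A a traceless Hermitian involution, and the six
projectors on a qubit sum to 3. Averaging over the other qubits therefore turns the cost into 1/12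
times a sum of terms 1 - overlap, one for each qubit i and each stabilizer label t. Here the overlap
compares U A_i U† with A at the place π(i), where π is the permutation of the target
(`cost_eq_sum_overlap`). Every overlap is at most 1.

For T ⊆ S, let the circuit perform the exchanges of S \ T exactly and be the identity elsewhere.
Then only the two end qubits of each block of T are misplaced, and each costs 1/2, so the cost is at
most |T| (`cost_swapParams_sdiff_le`). Conversely, suppose that in each block of T the four outer
gates satisfy cos² ≥ 1/2. Then the cost is at least |T|, whatever the other parameters are
(`card_le_cost`). Moving those outer angles by at most π/4 away from 0 preserves the hypothesis, so
these points are local minima of value |T|. The case T = ∅ gives the global minimum 0, and the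
nonempty T are the 2^|S| - 1 suboptimal points.

The heart is the bound for one block a, b, c, d (`re_trace_block_le`): the overlaps a→d, b→b, c→c,
d→a sum to at most 2. With middle angle β, each hop between the ends has weight at most sin²β/4
(`trace_hop`, `hop_weight_le`), because weight must pass through two outer gates that are at most
half open. Each inner qubit keeps weight at most 1 - sin²β/4 (`re_trace_stay_le`, `stay_weight_le`).
What opening the middle gate gains for the ends, it costs the inner qubits. -/

variable {n : ℕ}

/-! ### Product operators and one-qubit operators -/

/-- The operator `⊗_i A_i`. -/
def tensorOp (A : Fin n → Matrix (Fin 2) (Fin 2) ℂ) : Op n :=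
  Matrix.of fun x y => ∏ i, A i (x i) (y i)

theorem tensorOp_apply (A : Fin n → Matrix (Fin 2) (Fin 2) ℂ) (x y : Basis n) :
    tensorOp A x y = ∏ i, A i (x i) (y i) := rfl

theorem tensorOp_mul (A B : Fin n → Matrix (Fin 2) (Fin 2) ℂ) :
    tensorOp A * tensorOp B = tensorOp (A * B) := by
  ext x y
  simp only [Matrix.mul_apply, tensorOp_apply, Pi.mul_apply, Finset.prod_univ_sum,
    Fintype.piFinset_univ, Finset.prod_mul_distrib]

theorem tensorOp_one : tensorOp (1 : Fin n → Matrix (Fin 2) (Fin 2) ℂ) = 1 := by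
  ext x y
  simp only [tensorOp_apply, Pi.one_apply, Matrix.one_apply, Finset.prod_ite_zero,
    Finset.prod_const_one, Finset.mem_univ, forall_const, funext_iff]

theorem conjTranspose_tensorOp (A : Fin n → Matrix (Fin 2) (Fin 2) ℂ) :
    (tensorOp A)ᴴ = tensorOp fun i => (A i)ᴴ := by
  ext x y
  simp [tensorOp_apply, Matrix.conjTranspose_apply]

/-- The one-qubit operator `A` on the qubit `i`. -/
def site (i : Fin n) (A : Matrix (Fin 2) (Fin 2) ℂ) : Op n := tensorOp (Pi.mulSingle i A)

theorem site_apply (i : Fin n) (A : Matrix (Fin 2) (Fin 2) ℂ) (x y : Basis n) :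
    site i A x y = A (x i) (y i) *
      ∏ k ∈ Finset.univ.erase i, (1 : Matrix (Fin 2) (Fin 2) ℂ) (x k) (y k) := by
  rw [site, tensorOp_apply, ← Finset.mul_prod_erase _ _ (Finset.mem_univ i), Pi.mulSingle_eq_same]
  congr 1
  refine Finset.prod_congr rfl fun k hk => ?_
  rw [Pi.mulSingle_eq_of_ne (Finset.ne_of_mem_erase hk)]

theorem site_mul (i : Fin n) (A B : Matrix (Fin 2) (Fin 2) ℂ) :
    site i A * site i B = site i (A * B) := by
  rw [site, site, tensorOp_mul, ← Pi.mulSingle_mul, site]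

theorem site_one (i : Fin n) : site i 1 = 1 := by
  rw [site, Pi.mulSingle_one, tensorOp_one]

theorem site_add (i : Fin n) (A B : Matrix (Fin 2) (Fin 2) ℂ) :
    site i (A + B) = site i A + site i B := by
  ext x y
  simp [site_apply, add_mul]

theorem site_smul (i : Fin n) (c : ℂ) (A : Matrix (Fin 2) (Fin 2) ℂ) :
    site i (c • A) = c • site i A := by
  ext x y
  simp [site_apply, mul_assoc]

theorem site_zero (i : Fin n) : site i 0 = 0 := by
  ext x y
  simp [site_apply]

theorem site_sum {ι : Type*} (s : Finset ι) (i : Fin n) (A : ι → Matrix (Fin 2) (Fin 2) ℂ) :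
    site i (∑ k ∈ s, A k) = ∑ k ∈ s, site i (A k) := by
  classical
  induction s using Finset.induction_on with
  | empty => simp [site_zero]
  | insert a s ha ih => rw [Finset.sum_insert ha, Finset.sum_insert ha, site_add, ih]

theorem conjTranspose_site (i : Fin n) (A : Matrix (Fin 2) (Fin 2) ℂ) :
    (site i A)ᴴ = site i Aᴴ := by
  rw [site, conjTranspose_tensorOp, site]
  congr 1
  funext k
  rcases eq_or_ne k i with rfl | h
  · simp
  · simp [Pi.mulSingle_eq_of_ne h]

theorem site_commute {i j : Fin n} (h : i ≠ j) (A B : Matrix (Fin 2) (Fin 2) ℂ) :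
    Commute (site i A) (site j B) := by
  rw [Commute, SemiconjBy, site, site, tensorOp_mul, tensorOp_mul]
  congr 1
  funext k
  rcases eq_or_ne k i with rfl | hk
  · simp [Pi.mulSingle_eq_of_ne h]
  · simp [Pi.mulSingle_eq_of_ne hk]

/-! ### Qubit permutations and swaps -/

/-- The operator that permutes the qubits, the state of the qubit `i` being moved to `π i`. -/
def permOp (π : Equiv.Perm (Fin n)) : Op n :=
  Matrix.of fun x y => if x ∘ π = y then 1 else 0

theorem permOp_apply (π : Equiv.Perm (Fin n)) (x y : Basis n) :
    permOp π x y = if x ∘ π = y then 1 else 0 := rfl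

theorem permOp_mul (π ρ : Equiv.Perm (Fin n)) : permOp π * permOp ρ = permOp (π * ρ) := by
  ext x y
  simp only [Matrix.mul_apply, permOp_apply, ite_mul, one_mul, zero_mul, Finset.sum_ite_eq,
    Finset.mem_univ, if_true, Function.comp_assoc, Equiv.Perm.coe_mul]
  congr

theorem permOp_one : permOp (1 : Equiv.Perm (Fin n)) = 1 := by
  ext x y
  simp [permOp_apply, Matrix.one_apply]

theorem comp_perm_eq_iff (π : Equiv.Perm (Fin n)) (x y : Basis n) :
    x ∘ π = y ↔ x = y ∘ (π⁻¹ : Equiv.Perm (Fin n)) := by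
  constructor
  · rintro rfl
    funext i
    simp
  · rintro rfl
    funext i
    simp

theorem conjTranspose_permOp (π : Equiv.Perm (Fin n)) : (permOp π)ᴴ = permOp π⁻¹ := by
  ext x y
  simp only [Matrix.conjTranspose_apply, permOp_apply, apply_ite star, star_one, star_zero]
  refine if_congr ?_ rfl rfl
  rw [comp_perm_eq_iff π y x, eq_comm]

theorem swap_eq_permOp (a b : Fin n) : swap a b = permOp (Equiv.swap a b) := by
  ext x y
  simp only [swap, Matrix.of_apply, permOp_apply, comp_perm_eq_iff, Equiv.swap_inv]

theorem permOp_mul_tensorOp (π : Equiv.Perm (Fin n)) (A : Fin n → Matrix (Fin 2) (Fin 2) ℂ) :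
    permOp π * tensorOp (A ∘ π) = tensorOp A * permOp π := by
  ext x y
  simp only [Matrix.mul_apply, permOp_apply, tensorOp_apply, ite_mul, one_mul, zero_mul, mul_ite,
    mul_one, mul_zero, comp_perm_eq_iff π _ y, Finset.sum_ite_eq, Finset.sum_ite_eq',
    Finset.mem_univ, if_true]
  rw [← Equiv.prod_comp π fun i => A i (x i) ((y ∘ (π⁻¹ : Equiv.Perm (Fin n))) i)]
  simp

theorem permOp_mul_site (π : Equiv.Perm (Fin n)) (i : Fin n) (A : Matrix (Fin 2) (Fin 2) ℂ) :
    permOp π * site i A = site (π i) A * permOp π := by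
  rw [site, site, ← permOp_mul_tensorOp]
  congr 2
  funext k
  rcases eq_or_ne k i with rfl | h
  · simp
  · simp [Pi.mulSingle_eq_of_ne h, Pi.mulSingle_eq_of_ne (π.injective.ne h)]

theorem permOp_mul_site_mul_conjTranspose (π : Equiv.Perm (Fin n)) (i : Fin n)
    (A : Matrix (Fin 2) (Fin 2) ℂ) :
    permOp π * site i A * (permOp π)ᴴ = site (π i) A := by
  rw [permOp_mul_site, mul_assoc, conjTranspose_permOp, permOp_mul, mul_inv_cancel, permOp_one,
    mul_one]

theorem smul_permOp_inj {c d : ℂ} (hc : c ≠ 0) {π ρ : Equiv.Perm (Fin n)}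
    (h : c • permOp π = d • permOp ρ) : π = ρ := by
  ext i
  have key : ∀ x : Basis n, x ∘ π = x ∘ ρ := by
    intro x
    have := congrFun (congrFun h x) (x ∘ π)
    simp only [Matrix.smul_apply, permOp_apply, if_true, smul_eq_mul, mul_one] at this
    by_contra hne
    rw [if_neg (fun h' => hne h'.symm), mul_zero] at this
    exact hc this
  -- A basis state with a single 1, placed at `π i`, detects where `i` is sent.
  have := congrFun (key (Pi.single (π i) 1)) i
  simp only [Function.comp_apply, Pi.single_eq_same] at this
  by_contra hne
  rw [Pi.single_eq_of_ne (fun h' => hne (by rw [h']))] at this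
  exact one_ne_zero this

theorem swap_mul_self (a b : Fin n) : swap a b * swap a b = 1 := by
  rw [swap_eq_permOp, permOp_mul, Equiv.swap_mul_self, permOp_one]

theorem conjTranspose_swap (a b : Fin n) : (swap a b)ᴴ = swap a b := by
  rw [swap_eq_permOp, conjTranspose_permOp, Equiv.swap_inv]

theorem swap_comm (a b : Fin n) : swap a b = swap b a := by
  rw [swap_eq_permOp, swap_eq_permOp, Equiv.swap_comm]

theorem swap_mul_site_left (a b : Fin n) (A : Matrix (Fin 2) (Fin 2) ℂ) :
    swap a b * site a A = site b A * swap a b := by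
  rw [swap_eq_permOp, permOp_mul_site, Equiv.swap_apply_left]

theorem swap_mul_site_right (a b : Fin n) (A : Matrix (Fin 2) (Fin 2) ℂ) :
    swap a b * site b A = site a A * swap a b := by
  rw [swap_eq_permOp, permOp_mul_site, Equiv.swap_apply_right]

/-- SWAP = Σ |k⟩⟨l| ⊗ |l⟩⟨k|. This reduces commutation and partial-trace facts about swaps to
one-qubit operators. -/
theorem swap_eq_sum_site {a b : Fin n} (h : a ≠ b) :
    swap a b = ∑ k : Fin 2, ∑ l : Fin 2,
      site a (Matrix.single k l 1) * site b (Matrix.single l k 1) := by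
  ext x y
  have key : ∀ k l : Fin 2, (site a (Matrix.single k l 1) * site b (Matrix.single l k 1)) x y =
      (if x a = k ∧ y a = l ∧ x b = l ∧ y b = k then 1 else 0) *
        ∏ i ∈ (Finset.univ.erase a).erase b, (1 : Matrix (Fin 2) (Fin 2) ℂ) (x i) (y i) := by
    intro k l
    rw [site, site, tensorOp_mul, tensorOp_apply,
      ← Finset.mul_prod_erase _ _ (Finset.mem_univ a),
      ← Finset.mul_prod_erase _ _ (Finset.mem_erase.2 ⟨h.symm, Finset.mem_univ b⟩), ← mul_assoc]
    congr 1
    · simp only [Pi.mul_apply, Pi.mulSingle_eq_same, Pi.mulSingle_eq_of_ne h,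
        Pi.mulSingle_eq_of_ne h.symm, mul_one, one_mul, Matrix.single_apply, ← ite_and, ite_mul,
        zero_mul]
      refine if_congr ?_ rfl rfl
      tauto
    · refine Finset.prod_congr rfl fun i hi => ?_
      have hb := Finset.ne_of_mem_erase hi
      have ha := Finset.ne_of_mem_erase (Finset.mem_of_mem_erase hi)
      simp [Pi.mulSingle_eq_of_ne ha, Pi.mulSingle_eq_of_ne hb]
  simp only [Matrix.sum_apply, key]
  have hsum : ∀ p : ℂ, ∑ k : Fin 2, ∑ l : Fin 2,
      (if x a = k ∧ y a = l ∧ x b = l ∧ y b = k then (1 : ℂ) else 0) * p =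
        if x a = y b ∧ x b = y a then p else 0 := by
    intro p
    generalize x a = q; generalize x b = r; generalize y a = s; generalize y b = t
    fin_cases q <;> fin_cases r <;> fin_cases s <;> fin_cases t <;> simp
  rw [hsum]
  simp only [Matrix.one_apply, Finset.prod_ite_zero, Finset.prod_const_one, ← ite_and, swap,
    Matrix.of_apply]
  refine if_congr ?_ rfl rfl
  constructor
  · rintro rfl
    refine ⟨⟨by simp, by simp⟩, fun i hi => ?_⟩
    have hb := Finset.ne_of_mem_erase hi
    have ha := Finset.ne_of_mem_erase (Finset.mem_of_mem_erase hi)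
    simp [Equiv.swap_apply_of_ne_of_ne ha hb]
  · rintro ⟨⟨h1, h2⟩, h3⟩
    funext i
    by_cases ha : i = a
    · subst ha; simpa using h1
    by_cases hb : i = b
    · subst hb; simpa using h2
    · simpa [Equiv.swap_apply_of_ne_of_ne ha hb] using h3 i (by simp [ha, hb])

/-! ### Operators trivial on a qubit, and vanishing partial traces -/

/-- The operators that act trivially on the qubit `a`. -/
def triv (a : Fin n) : StarSubalgebra ℂ (Op n) :=
  StarSubalgebra.centralizer ℂ (Set.range (site a))

theorem mem_triv {a : Fin n} {Y : Op n} : Y ∈ triv a ↔ ∀ A, Commute Y (site a A) := by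
  simp only [triv, StarSubalgebra.mem_centralizer_iff, Set.forall_mem_range,
    Matrix.star_eq_conjTranspose, conjTranspose_site]
  exact ⟨fun h A => (h A).1.symm, fun h A => ⟨(h A).symm, (h Aᴴ).symm⟩⟩

theorem conjTranspose_mem_triv {a : Fin n} {Y : Op n} (h : Y ∈ triv a) : Yᴴ ∈ triv a :=
  star_mem h

theorem site_mem_triv {a b : Fin n} (h : a ≠ b) (A : Matrix (Fin 2) (Fin 2) ℂ) :
    site a A ∈ triv b :=
  mem_triv.2 fun B => site_commute h A B

theorem swap_mem_triv {a b c : Fin n} (ha : c ≠ a) (hb : c ≠ b) : swap a b ∈ triv c :=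
  mem_triv.2 fun A => by
    rw [Commute, SemiconjBy, swap_eq_permOp, permOp_mul_site,
      Equiv.swap_apply_of_ne_of_ne ha hb]

theorem commute_swap {a b : Fin n} (hab : a ≠ b) {Y : Op n} (ha : Y ∈ triv a) (hb : Y ∈ triv b) :
    Commute Y (swap a b) := by
  rw [swap_eq_sum_site hab]
  exact Commute.sum_right _ _ _ fun k _ => Commute.sum_right _ _ _ fun l _ =>
    (mem_triv.1 ha _).mul_right (mem_triv.1 hb _)

/-- Cyclicity of the partial trace over `b`: an operator trivial on `b` lets `site b A` pass through
it. With matrix units for `A` and `B`, this does the work of a partial trace without forming one. -/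
theorem trace_site_mul_mul_site_mul {b : Fin n} {D : Op n} (hD : D ∈ triv b) (Z : Op n)
    (A B : Matrix (Fin 2) (Fin 2) ℂ) :
    (site b A * Z * site b B * D).trace = (Z * site b (B * A) * D).trace := by
  rw [mul_assoc, mul_assoc, Matrix.trace_mul_comm, mul_assoc, mul_assoc, (mem_triv.1 hD A).eq,
    ← mul_assoc (site b B), site_mul, ← mul_assoc]

theorem sum_single_mul_single_mul (A : Matrix (Fin 2) (Fin 2) ℂ) :
    ∑ k : Fin 2, ∑ l : Fin 2, Matrix.single l k (1 : ℂ) * A * Matrix.single k l 1 =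
      A.trace • (1 : Matrix (Fin 2) (Fin 2) ℂ) := by
  ext i j
  fin_cases i <;> fin_cases j <;>
    simp [Fin.sum_univ_two, Matrix.trace]

theorem sum_single_mul_single :
    ∑ k : Fin 2, ∑ l : Fin 2, Matrix.single k l (1 : ℂ) * Matrix.single l k (1 : ℂ) =
      (2 : ℂ) • (1 : Matrix (Fin 2) (Fin 2) ℂ) := by
  ext i j
  fin_cases i <;> fin_cases j <;> norm_num [Fin.sum_univ_two, Matrix.single_apply]

/-- The partial trace of a swap over one of its qubits is the identity. -/
theorem two_mul_trace_swap_mul {a b : Fin n} (hab : a ≠ b) {D : Op n} (hD : D ∈ triv b) :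
    2 * (swap a b * D).trace = D.trace := by
  -- Moving the right-hand matrix unit through the swap leaves Σ (|l⟩⟨k|)_b (|k⟩⟨l|)_a · SWAP =
  -- SWAP² = 1.
  have h1 : (1 : Op n) = ∑ k : Fin 2, ∑ l : Fin 2,
      site b (Matrix.single l k 1) * swap a b * site b (Matrix.single k l 1) := by
    simp only [mul_assoc, swap_mul_site_right]
    simp only [← mul_assoc, ← Finset.sum_mul]
    rw [← swap_mul_self a b]
    congr 1
    rw [swap_eq_sum_site hab]
    exact Finset.sum_congr rfl fun k _ => Finset.sum_congr rfl fun l _ =>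
      (site_commute hab _ _).eq
  calc 2 * (swap a b * D).trace
      = ∑ k : Fin 2, ∑ l : Fin 2,
          (swap a b * site b (Matrix.single k l 1 * Matrix.single l k 1) * D).trace := by
        simp only [← Matrix.trace_sum, ← Finset.sum_mul, ← Finset.mul_sum, ← site_sum]
        rw [sum_single_mul_single, site_smul, site_one]
        simp
    _ = D.trace := by
        simp only [← trace_site_mul_mul_site_mul hD, ← Matrix.trace_sum, ← Finset.sum_mul]
        rw [← h1, one_mul]

/-- `Z` has zero partial trace over the qubit `a`. -/
def TracelessAt (a : Fin n) (Z : Op n) : Prop := ∀ Y ∈ triv a, (Z * Y).trace = 0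

theorem TracelessAt.trace_mul_left {a : Fin n} {Z Y : Op n} (hZ : TracelessAt a Z)
    (hY : Y ∈ triv a) : (Y * Z).trace = 0 := by
  rw [Matrix.trace_mul_comm, hZ Y hY]

/-- Twirling by matrix units replaces `A` by a multiple of its trace. -/
theorem tracelessAt_site (a : Fin n) {A : Matrix (Fin 2) (Fin 2) ℂ} (hA : A.trace = 0) :
    TracelessAt a (site a A) := by
  intro Y hY
  have h : 2 * (site a A * Y).trace = 0 := by
    calc 2 * (site a A * Y).trace
        = ∑ k : Fin 2, ∑ l : Fin 2,
            (site a A * site a (Matrix.single k l 1 * Matrix.single l k 1) * Y).trace := by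
          simp only [← Matrix.trace_sum, ← Finset.sum_mul, ← Finset.mul_sum, ← site_sum]
          rw [sum_single_mul_single, site_smul, site_one]
          simp
      _ = 0 := by
          simp only [← trace_site_mul_mul_site_mul hY]
          simp only [site_mul, ← Matrix.trace_sum, ← Finset.sum_mul, ← site_sum]
          rw [sum_single_mul_single_mul, hA]
          simp [site_zero]
  simpa using h

/-! ### The commutator term created by an exchange gate -/

/-- The commutator of the swap of `a` and `b` with a one-qubit operator on `a`. -/
def swapBracket (a b : Fin n) (A : Matrix (Fin 2) (Fin 2) ℂ) : Op n :=
  swap a b * site a A - site a A * swap a b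

/-- Since Y commutes with A_a, cyclicity makes the two halves of Tr([SWAP, A_a] Y) cancel. -/
theorem tracelessAt_swapBracket_left (a b : Fin n) (A : Matrix (Fin 2) (Fin 2) ℂ) :
    TracelessAt a (swapBracket a b A) := by
  intro Y hY
  rw [swapBracket, sub_mul, Matrix.trace_sub, mul_assoc (site a A),
    Matrix.trace_mul_comm (site a A),
    mul_assoc, mul_assoc, (mem_triv.1 hY A).eq, sub_self]

/-- Because SWAP A_a = A_b SWAP, the bracket is also minus the commutator of SWAP with A_b, so the
argument for `a` applies to `b`. -/
theorem tracelessAt_swapBracket_right (a b : Fin n) (A : Matrix (Fin 2) (Fin 2) ℂ) :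
    TracelessAt b (swapBracket a b A) := by
  intro Y hY
  rw [swapBracket, swap_mul_site_left, ← swap_mul_site_right, sub_mul, Matrix.trace_sub,
    mul_assoc (site b A), Matrix.trace_mul_comm (site b A), mul_assoc, mul_assoc,
    (mem_triv.1 hY A).eq, sub_self]

theorem swapBracket_mem_triv {a b c : Fin n} (ha : c ≠ a) (hb : c ≠ b)
    (A : Matrix (Fin 2) (Fin 2) ℂ) : swapBracket a b A ∈ triv c :=
  sub_mem (mul_mem (swap_mem_triv ha hb) (site_mem_triv ha.symm A))
    (mul_mem (site_mem_triv ha.symm A) (swap_mem_triv ha hb))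

theorem conjTranspose_swapBracket (a b : Fin n) {A : Matrix (Fin 2) (Fin 2) ℂ} (hA : Aᴴ = A) :
    (swapBracket a b A)ᴴ = -swapBracket a b A := by
  simp [swapBracket, conjTranspose_site, conjTranspose_swap, hA]

/-- The square of the bracket is 2 A_a A_b - 2, and the first summand is traceless. For Hermitian A
this fixes the Hilbert–Schmidt norm of the bracket, the source of the factor 2 in
`re_trace_stay_le`. -/
theorem trace_swapBracket_mul_self {a b : Fin n} (hab : a ≠ b) {A : Matrix (Fin 2) (Fin 2) ℂ}
    (hA : A.trace = 0) (hA2 : A * A = 1) :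
    (swapBracket a b A * swapBracket a b A).trace = -(2 * 2 ^ n) := by
  have h1 : swapBracket a b A * swapBracket a b A =
      (2 : ℂ) • (site a A * site b A) - (2 : ℂ) • 1 := by
    have hS := swap_mul_self a b
    have hAA : site a A * site a A = 1 := by rw [site_mul, hA2, site_one]
    have hc := (site_commute hab A A).eq
    have e1 : swap a b * site a A * (swap a b * site a A) = site a A * site b A := by
      rw [hc]
      nth_rewrite 1 [swap_mul_site_left]
      rw [mul_assoc, ← mul_assoc (swap a b), hS, one_mul]
    have e2 : swap a b * site a A * (site a A * swap a b) = 1 := by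
      rw [mul_assoc, ← mul_assoc (site a A), hAA, one_mul, hS]
    have e3 : site a A * swap a b * (swap a b * site a A) = 1 := by
      rw [mul_assoc, ← mul_assoc (swap a b), hS, one_mul, hAA]
    have e4 : site a A * swap a b * (site a A * swap a b) = site a A * site b A := by
      rw [mul_assoc, ← mul_assoc (swap a b), swap_mul_site_left, mul_assoc (site b A), hS, mul_one]
    rw [swapBracket, mul_sub, sub_mul, sub_mul, e1, e2, e3, e4]
    module
  rw [h1, Matrix.trace_sub, Matrix.trace_smul, Matrix.trace_smul,
    tracelessAt_site a hA _ (site_mem_triv hab.symm A), Matrix.trace_one]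
  simp

/-! ### Exchange gates and conjugation by them -/

theorem exp_smul_of_mul_self_eq_one (z : ℂ) {S : Op n} (hS : S * S = 1) :
    NormedSpace.exp (z • S) = Complex.cosh z • (1 : Op n) + Complex.sinh z • S := by
  -- Split along the spectral projections (1 ± S)/2, so that the series becomes two scalar
  -- exponential series.
  have hpow : ∀ k : ℕ, ((k.factorial : ℂ)⁻¹) • (z • S) ^ k =
      (z ^ k / k.factorial) • ((1 / 2 : ℂ) • (1 + S)) +
        ((-z) ^ k / k.factorial) • ((1 / 2 : ℂ) • (1 - S)) := by
    intro k
    have : (z • S) ^ k = z ^ k • ((1 / 2 : ℂ) • (1 + S)) + (-z) ^ k • ((1 / 2 : ℂ) • (1 - S)) := by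
      induction k with
      | zero => simp only [pow_zero]; module
      | succ k ih =>
        rw [pow_succ, ih]
        simp only [add_mul, smul_mul_assoc, mul_smul_comm, sub_mul, one_mul, hS, pow_succ]
        module
    rw [this]
    module
  have hsum : HasSum (fun k : ℕ => ((k.factorial : ℂ)⁻¹) • (z • S) ^ k)
      (Complex.exp z • ((1 / 2 : ℂ) • (1 + S)) + Complex.exp (-z) • ((1 / 2 : ℂ) • (1 - S))) := by
    simp only [hpow, Complex.exp_eq_exp_ℂ]
    exact ((NormedSpace.expSeries_div_hasSum_exp z).smul_const _).add
      ((NormedSpace.expSeries_div_hasSum_exp (-z)).smul_const _)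
  rw [NormedSpace.exp_eq_tsum ℂ]
  refine hsum.tsum_eq.trans ?_
  rw [Complex.cosh, Complex.sinh]
  module
theorem swapRot_eq (t : ℝ) (a b : Fin n) :
    swapRot t a b = (Real.cos t : ℂ) • (1 : Op n) + (Complex.I * Real.sin t) • swap a b := by
  rw [swapRot, exp_smul_of_mul_self_eq_one _ (swap_mul_self a b), mul_comm Complex.I,
    Complex.cosh_mul_I, Complex.sinh_mul_I, Complex.ofReal_cos, Complex.ofReal_sin,
    mul_comm Complex.I]

theorem swapRot_zero (a b : Fin n) : swapRot 0 a b = 1 := by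
  simp [swapRot_eq]

theorem swapRot_pi_div_two (a b : Fin n) : swapRot (Real.pi / 2) a b = Complex.I • swap a b := by
  simp [swapRot_eq]

theorem swapRot_comm (t : ℝ) (a b : Fin n) : swapRot t a b = swapRot t b a := by
  rw [swapRot_eq, swapRot_eq, swap_comm]

theorem conjTranspose_swapRot (t : ℝ) (a b : Fin n) : (swapRot t a b)ᴴ = swapRot (-t) a b := by
  simp [swapRot_eq, conjTranspose_swap, Complex.conj_ofReal, -Complex.ofReal_cos,
    -Complex.ofReal_sin]

theorem swapRot_mul (s t : ℝ) (a b : Fin n) :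
    swapRot s a b * swapRot t a b = swapRot (s + t) a b := by
  have hI := Complex.I_mul_I
  simp only [swapRot_eq, add_mul, mul_add, smul_mul_assoc, mul_smul_comm, one_mul, mul_one,
    swap_mul_self, Real.cos_add, Real.sin_add, smul_smul, smul_add]
  push_cast
  match_scalars
  · linear_combination (Complex.sin s * Complex.sin t) * hI
  · ring

theorem swapRot_mem_unitary (t : ℝ) (a b : Fin n) : swapRot t a b ∈ unitary (Op n) := by
  rw [Unitary.mem_iff, Matrix.star_eq_conjTranspose, conjTranspose_swapRot, swapRot_mul,
    swapRot_mul, neg_add_cancel, add_neg_cancel, swapRot_zero]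
  exact ⟨rfl, rfl⟩

theorem swapRot_mem_triv {a b c : Fin n} (ha : c ≠ a) (hb : c ≠ b) (t : ℝ) :
    swapRot t a b ∈ triv c := by
  rw [swapRot_eq]
  exact add_mem (SMulMemClass.smul_mem _ (one_mem _))
    (SMulMemClass.smul_mem _ (swap_mem_triv ha hb))

theorem commute_swapRot {a b : Fin n} (hab : a ≠ b) {Y : Op n} (ha : Y ∈ triv a) (hb : Y ∈ triv b)
    (t : ℝ) : Commute Y (swapRot t a b) := by
  rw [swapRot_eq]
  exact ((Commute.one_right Y).smul_right _).add_right ((commute_swap hab ha hb).smul_right _)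

theorem swapRot_mul_mul_conjTranspose (t : ℝ) (a b : Fin n) (Y : Op n) :
    swapRot t a b * Y * (swapRot t a b)ᴴ =
      ((Real.cos t : ℂ) ^ 2) • Y + ((Real.sin t : ℂ) ^ 2) • (swap a b * Y * swap a b) +
        (Complex.I * Real.sin t * Real.cos t) • (swap a b * Y - Y * swap a b) := by
  have hI := Complex.I_mul_I
  rw [conjTranspose_swapRot]
  simp only [swapRot_eq, add_mul, mul_add, smul_mul_assoc, mul_smul_comm, one_mul, mul_one,
    Real.cos_neg, Real.sin_neg, smul_smul, smul_add, smul_sub, mul_assoc (swap a b)]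
  push_cast
  match_scalars
  · ring
  · ring
  · ring
  · linear_combination (-Complex.sin t ^ 2) * hI

theorem swap_mul_site_mul_swap (a b : Fin n) (A : Matrix (Fin 2) (Fin 2) ℂ) :
    swap a b * site a A * swap a b = site b A := by
  rw [swap_mul_site_left, mul_assoc, swap_mul_self, mul_one]

theorem swapRot_conj_site (t : ℝ) (a b : Fin n) (A : Matrix (Fin 2) (Fin 2) ℂ) :
    swapRot t a b * site a A * (swapRot t a b)ᴴ =
      ((Real.cos t : ℂ) ^ 2) • site a A + ((Real.sin t : ℂ) ^ 2) • site b A +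
        (Complex.I * Real.sin t * Real.cos t) • swapBracket a b A := by
  rw [swapRot_mul_mul_conjTranspose, swap_mul_site_mul_swap, swapBracket]

theorem swap_mul_mul_swap_mem_triv {a b : Fin n} {Y : Op n} (hY : Y ∈ triv b) :
    swap a b * Y * swap a b ∈ triv a := by
  refine mem_triv.2 fun A => ?_
  rw [Commute, SemiconjBy, mul_assoc, swap_mul_site_left, ← mul_assoc, mul_assoc (swap a b) Y,
    (mem_triv.1 hY A).eq, ← mul_assoc, swap_mul_site_right]
  simp only [mul_assoc]

/-- An exchange gate damps the overlap of two operators that are trivial on one of its qubits, if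
one of them is traceless on the other qubit. -/
theorem trace_swapRot_conj_mul {a b : Fin n} (hab : a ≠ b) (t : ℝ) {Y Z : Op n} (hY : Y ∈ triv b)
    (hZ : Z ∈ triv b) (hZ0 : TracelessAt a Z) :
    (swapRot t a b * Y * (swapRot t a b)ᴴ * Z).trace = (Real.cos t : ℂ) ^ 2 * (Y * Z).trace := by
  -- Tr([SWAP, Y] Z) = Tr(SWAP [Y, Z]). As [Y, Z] is trivial on `b`, this is half of Tr [Y, Z] = 0.
  have h1 : ((swap a b * Y - Y * swap a b) * Z).trace = 0 := by
    have h2 := two_mul_trace_swap_mul hab (D := Y * Z - Z * Y)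
      (sub_mem (mul_mem hY hZ) (mul_mem hZ hY))
    rw [Matrix.trace_sub, Matrix.trace_mul_comm Y, sub_self] at h2
    have h3 : ((swap a b * Y - Y * swap a b) * Z).trace =
        (swap a b * (Y * Z - Z * Y)).trace := by
      rw [sub_mul, mul_sub, Matrix.trace_sub, Matrix.trace_sub, mul_assoc, mul_assoc Y,
        Matrix.trace_mul_comm Y, mul_assoc]
    rw [h3]
    simpa using h2
  rw [swapRot_mul_mul_conjTranspose, add_mul, add_mul, Matrix.trace_add, Matrix.trace_add]
  simp only [smul_mul_assoc, Matrix.trace_smul, h1,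
    hZ0.trace_mul_left (swap_mul_mul_swap_mem_triv hY), mul_zero, add_zero, smul_eq_mul]

/-- The overlap of a one-qubit operator with its copy on the other qubit of an exchange gate. -/
theorem trace_swapRot_conj_site_mul_site {a b : Fin n} (hab : a ≠ b) (t : ℝ)
    {A : Matrix (Fin 2) (Fin 2) ℂ} (hA : A.trace = 0) (hA2 : A * A = 1) :
    (swapRot t a b * site a A * (swapRot t a b)ᴴ * site b A).trace =
      (Real.sin t : ℂ) ^ 2 * 2 ^ n := by
  rw [swapRot_conj_site, add_mul, add_mul, Matrix.trace_add, Matrix.trace_add]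
  simp only [smul_mul_assoc, Matrix.trace_smul, smul_eq_mul]
  rw [tracelessAt_site a hA _ (site_mem_triv hab.symm A),
    tracelessAt_swapBracket_left a b A _ (site_mem_triv hab.symm A), site_mul, hA2, site_one,
    Matrix.trace_one]
  simp

theorem trace_swapRot_conj_site_mul_self {a b : Fin n} (hab : a ≠ b) (t : ℝ)
    {A : Matrix (Fin 2) (Fin 2) ℂ} (hA : A.trace = 0) (hA2 : A * A = 1) :
    (swapRot t a b * site a A * (swapRot t a b)ᴴ * site a A).trace =
      (Real.cos t : ℂ) ^ 2 * 2 ^ n := by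
  rw [trace_swapRot_conj_mul hab t (site_mem_triv hab A) (site_mem_triv hab A)
    (tracelessAt_site a hA), site_mul, hA2, site_one, Matrix.trace_one]
  simp

/-! ### Unitary conjugation and trace bounds -/

theorem conjTranspose_mul_self_of_mem_unitary {U : Op n} (hU : U ∈ unitary (Op n)) : Uᴴ * U = 1 :=
  (Unitary.mem_iff.1 hU).1

theorem mul_conjTranspose_self_of_mem_unitary {U : Op n} (hU : U ∈ unitary (Op n)) : U * Uᴴ = 1 :=
  (Unitary.mem_iff.1 hU).2

theorem conj_eq_self {R Y : Op n} (hR : R ∈ unitary (Op n)) (h : Commute R Y) : R * Y * Rᴴ = Y := by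
  rw [h.eq, mul_assoc, mul_conjTranspose_self_of_mem_unitary hR, mul_one]

theorem conj_eq_self' {R Y : Op n} (hR : R ∈ unitary (Op n)) (h : Commute R Y) :
    Rᴴ * Y * R = Y := by
  rw [mul_assoc, ← h.eq, ← mul_assoc, conjTranspose_mul_self_of_mem_unitary hR, one_mul]

theorem conj_mul (U V Y : Op n) : U * V * Y * (U * V)ᴴ = U * (V * Y * Vᴴ) * Uᴴ := by
  simp only [Matrix.conjTranspose_mul, mul_assoc]

theorem conj_mul' (U V Y : Op n) : (U * V)ᴴ * Y * (U * V) = Vᴴ * (Uᴴ * Y * U) * V := by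
  simp only [Matrix.conjTranspose_mul, mul_assoc]

-- Positivity of (Y ± Z)†(Y ± Z): the arithmetic-mean form of Cauchy–Schwarz, which loses nothing
-- for operators of equal norm.
open scoped ComplexOrder in
theorem abs_re_trace_le (Y Z : Op n) :
    |(Yᴴ * Z).trace.re| ≤ ((Yᴴ * Y).trace.re + (Zᴴ * Z).trace.re) / 2 := by
  have h1 : (Zᴴ * Y).trace.re = (Yᴴ * Z).trace.re := by
    rw [← Complex.conj_re, ← Complex.star_def, ← Matrix.trace_conjTranspose]
    simp
  have hp := (Complex.le_def.1 (Matrix.posSemidef_conjTranspose_mul_self (Y + Z)).trace_nonneg).1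
  have hm := (Complex.le_def.1 (Matrix.posSemidef_conjTranspose_mul_self (Y - Z)).trace_nonneg).1
  simp only [Matrix.conjTranspose_add, Matrix.conjTranspose_sub, add_mul, mul_add, sub_mul,
    mul_sub, Matrix.trace_add, Matrix.trace_sub, Complex.add_re, Complex.sub_re, h1,
    Complex.zero_re] at hp hm
  rw [abs_le]
  constructor <;> linarith

theorem abs_re_trace_conj_mul_le {U : Op n} (hU : U ∈ unitary (Op n)) (Y Z : Op n) :
    |(U * Y * Uᴴ * Z).trace.re| ≤ ((Yᴴ * Y).trace.re + (Zᴴ * Z).trace.re) / 2 := by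
  have h := abs_re_trace_le (U * Y * Uᴴ)ᴴ Z
  have h1 : ((U * Y * Uᴴ) * (U * Y * Uᴴ)ᴴ).trace = (Yᴴ * Y).trace := by
    have : (U * Y * Uᴴ) * (U * Y * Uᴴ)ᴴ = U * (Y * (Uᴴ * U) * Yᴴ * Uᴴ) := by
      simp only [Matrix.conjTranspose_mul, Matrix.conjTranspose_conjTranspose, mul_assoc]
    rw [this, Matrix.trace_mul_comm, mul_assoc, conjTranspose_mul_self_of_mem_unitary hU, mul_one,
      mul_one, Matrix.trace_mul_comm]
  rwa [Matrix.conjTranspose_conjTranspose, h1] at h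

/-! ### The layers as seen from one block -/

/-- `E` is the gate `exp(i t SWAP_{a,b})` followed or preceded by operations on other qubits. -/
def PairFactor (t : ℝ) (a b : Fin n) (E : Op n) : Prop :=
  ∃ R ∈ unitary (Op n), R ∈ triv a ∧ R ∈ triv b ∧ E = swapRot t a b * R

theorem PairFactor.symm {t : ℝ} {a b : Fin n} {E : Op n} (h : PairFactor t a b E) :
    PairFactor t b a E := by
  obtain ⟨R, hR, ha, hb, rfl⟩ := h
  exact ⟨R, hR, hb, ha, by rw [swapRot_comm]⟩

theorem commute_swapBracket {a b : Fin n} (hab : a ≠ b) {R : Op n} (ha : R ∈ triv a)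
    (hb : R ∈ triv b) (A : Matrix (Fin 2) (Fin 2) ℂ) : Commute R (swapBracket a b A) :=
  (((commute_swap hab ha hb).mul_right (mem_triv.1 ha A))).sub_right
    ((mem_triv.1 ha A).mul_right (commute_swap hab ha hb))

theorem PairFactor.conj_site {t : ℝ} {a b : Fin n} {E : Op n} (h : PairFactor t a b E)
    (A : Matrix (Fin 2) (Fin 2) ℂ) :
    E * site a A * Eᴴ =
      ((Real.cos t : ℂ) ^ 2) • site a A + ((Real.sin t : ℂ) ^ 2) • site b A +
        (Complex.I * Real.sin t * Real.cos t) • swapBracket a b A := by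
  obtain ⟨R, hR, ha, hb, rfl⟩ := h
  rw [conj_mul, conj_eq_self hR (mem_triv.1 ha A), swapRot_conj_site]

theorem PairFactor.conj_site' {t : ℝ} {a b : Fin n} (hab : a ≠ b) {E : Op n}
    (h : PairFactor t a b E) (A : Matrix (Fin 2) (Fin 2) ℂ) :
    Eᴴ * site a A * E =
      ((Real.cos t : ℂ) ^ 2) • site a A + ((Real.sin t : ℂ) ^ 2) • site b A -
        (Complex.I * Real.sin t * Real.cos t) • swapBracket a b A := by
  obtain ⟨R, hR, ha, hb, rfl⟩ := h
  have h1 : (swapRot t a b)ᴴ * site a A * swapRot t a b =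
      ((Real.cos t : ℂ) ^ 2) • site a A + ((Real.sin t : ℂ) ^ 2) • site b A -
        (Complex.I * Real.sin t * Real.cos t) • swapBracket a b A := by
    have := swapRot_conj_site (-t) a b A
    rw [conjTranspose_swapRot, neg_neg, ← conjTranspose_swapRot, Real.cos_neg, Real.sin_neg] at this
    rw [this]
    push_cast
    module
  rw [conj_mul', h1]
  refine conj_eq_self' hR ?_
  exact ((((mem_triv.1 ha A).smul_right _).add_right ((mem_triv.1 hb A).smul_right _)).sub_right
    ((commute_swapBracket hab ha hb A).smul_right _))

/-- `M` is the gate `exp(i t SWAP_{b,c})` together with operations on the one side of the chain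
`a, b, c, d` and operations on the other side. -/
def ChainFactor (t : ℝ) (a b c d : Fin n) (M : Op n) : Prop :=
  ∃ L ∈ unitary (Op n), ∃ R ∈ unitary (Op n), (L ∈ triv b ∧ L ∈ triv c ∧ L ∈ triv d) ∧
    (R ∈ triv a ∧ R ∈ triv b ∧ R ∈ triv c) ∧ Commute L R ∧ M = swapRot t b c * (L * R)

theorem ChainFactor.symm {t : ℝ} {a b c d : Fin n} {M : Op n} (h : ChainFactor t a b c d M) :
    ChainFactor t d c b a M := by
  obtain ⟨L, hL, R, hR, ⟨hLb, hLc, hLd⟩, ⟨hRa, hRb, hRc⟩, hLR, rfl⟩ := h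
  exact ⟨R, hR, L, hL, ⟨hRc, hRb, hRa⟩, ⟨hLd, hLc, hLb⟩, hLR.symm, by
    rw [swapRot_comm, hLR.eq]⟩

theorem trace_conj_mul (U Y Z : Op n) : (U * Y * Uᴴ * Z).trace = (Y * (Uᴴ * Z * U)).trace := by
  rw [mul_assoc, mul_assoc, Matrix.trace_mul_comm]
  simp only [mul_assoc]

/-- The first layer evolves Y forwards, the last evolves Z backwards, and the two results are
compared across the middle layer. -/
theorem trace_layers (E₁ M E₂ Y Z : Op n) :
    (E₂ * M * E₁ * Y * (E₂ * M * E₁)ᴴ * Z).trace =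
      (M * (E₁ * Y * E₁ᴴ) * Mᴴ * (E₂ᴴ * Z * E₂)).trace := by
  rw [mul_assoc E₂, conj_mul, trace_conj_mul, conj_mul]

theorem re_trace_conj_site_le {U : Op n} (hU : U ∈ unitary (Op n)) (a b : Fin n)
    {A : Matrix (Fin 2) (Fin 2) ℂ} (hA2 : A * A = 1) (hAH : Aᴴ = A) :
    (U * site a A * Uᴴ * site b A).trace.re ≤ 2 ^ n := by
  refine (le_abs_self _).trans ((abs_re_trace_conj_mul_le hU _ _).trans_eq ?_)
  simp only [conjTranspose_site, hAH, site_mul, hA2, site_one, Matrix.trace_one]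
  simp
  norm_cast

/-! ### Overlap bounds for a block -/

/-- The weight that is carried from one end of a block to the other one. -/
theorem trace_hop {α β γ : ℝ} {a b c d : Fin n} (hab : a ≠ b) (hac : a ≠ c) (had : a ≠ d)
    (hbc : b ≠ c) (hbd : b ≠ d) (hcd : c ≠ d) {E₁ M E₂ : Op n} (h₁ : PairFactor α a b E₁)
    (hM : ChainFactor β a b c d M) (h₂ : PairFactor γ c d E₂) {A : Matrix (Fin 2) (Fin 2) ℂ}
    (hA : A.trace = 0) (hA2 : A * A = 1) :
    (E₂ * M * E₁ * site a A * (E₂ * M * E₁)ᴴ * site d A).trace =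
      ((Real.sin α : ℂ) ^ 2 * (Real.sin β : ℂ) ^ 2 * (Real.sin γ : ℂ) ^ 2) * 2 ^ n := by
  rw [trace_layers, h₁.conj_site, h₂.symm.conj_site' hcd.symm]
  obtain ⟨L, hL, R, hR, ⟨hLb, hLc, hLd⟩, ⟨hRa, hRb, hRc⟩, hLR, rfl⟩ := hM
  -- `L` may act on `a` and `R` on `d`. With `L` outermost, it cancels against anything it commutes
  -- with before it can spoil triviality on `a`.
  have hgL : swapRot β b c * (L * R) = L * swapRot β b c * R := by
    rw [← mul_assoc, (commute_swapRot hbc hLb hLc β).eq]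
  have hin : ∀ Z, Commute L Z → Z ∈ triv a →
      (swapRot β b c * (L * R) * swapBracket a b A * (swapRot β b c * (L * R))ᴴ * Z).trace = 0 := by
    intro Z hLZ hZ
    have e : (swapRot β b c * (L * R))ᴴ * Z * (swapRot β b c * (L * R)) ∈ triv a := by
      rw [hgL, conj_mul', conj_mul', conj_eq_self' hL hLZ]
      have hg := swapRot_mem_triv hab hac β
      exact mul_mem (mul_mem (conjTranspose_mem_triv hRa)
        (mul_mem (mul_mem (conjTranspose_mem_triv hg) hZ) hg)) hRa
    have := tracelessAt_swapBracket_left a b A _ e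
    rwa [trace_conj_mul]
  have hout : ∀ Y, Commute R Y → Y ∈ triv d →
      swapRot β b c * (L * R) * Y * (swapRot β b c * (L * R))ᴴ ∈ triv d := by
    intro Y hRY hY
    rw [hgL, conj_mul, conj_eq_self hR hRY, conj_mul]
    have hg := swapRot_mem_triv hbd.symm hcd.symm β
    exact mul_mem (mul_mem hLd (mul_mem (mul_mem hg hY) (conjTranspose_mem_triv hg)))
      (conjTranspose_mem_triv hLd)
  have hd0 := tracelessAt_site d hA
  have hx0 := tracelessAt_swapBracket_left d c A
  have t1 := hout _ (mem_triv.1 hRa A) (site_mem_triv had A)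
  have t2 := hout _ (mem_triv.1 hRb A) (site_mem_triv hbd A)
  have t3 : swapRot β b c * (L * R) * site a A * (swapRot β b c * (L * R))ᴴ ∈ triv c := by
    rw [hgL, conj_mul, conj_eq_self hR (mem_triv.1 hRa A), conj_mul,
      conj_eq_self (swapRot_mem_unitary β b c)
        (commute_swapRot hbc (site_mem_triv hab A) (site_mem_triv hac A) β).symm]
    exact mul_mem (mul_mem hLc (site_mem_triv hac A)) (conjTranspose_mem_triv hLc)
  have t4 : (swapRot β b c * (L * R) * site b A * (swapRot β b c * (L * R))ᴴ * site c A).trace =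
      (Real.sin β : ℂ) ^ 2 * 2 ^ n := by
    rw [conj_mul, conj_eq_self (mul_mem hL hR) (mem_triv.1 (mul_mem hLb hRb) A),
      trace_swapRot_conj_site_mul_site hbc β hA hA2]
  -- The outgoing bracket contributes nothing. Of the products that remain, only b → c through the
  -- middle gate survives.
  have z : ∀ p q r : ℂ, (swapRot β b c * (L * R) * swapBracket a b A * (swapRot β b c * (L * R))ᴴ *
      (p • site d A + q • site c A - r • swapBracket d c A)).trace = 0 := by
    intro p q r
    refine hin _ ?_ ?_
    · exact (((mem_triv.1 hLd A).smul_right _).add_right ((mem_triv.1 hLc A).smul_right _)).sub_right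
        ((commute_swapBracket hcd.symm hLd hLc A).smul_right _)
    · exact sub_mem (add_mem (SMulMemClass.smul_mem _ (site_mem_triv had.symm A))
        (SMulMemClass.smul_mem _ (site_mem_triv hac.symm A)))
        (SMulMemClass.smul_mem _ (swapBracket_mem_triv had hac A))
  generalize swapRot β b c * (L * R) = M at *
  simp only [mul_add, add_mul, mul_smul_comm, smul_mul_assoc, Matrix.trace_add, Matrix.trace_smul,
    z, smul_zero, add_zero]
  simp only [mul_add, mul_sub, mul_smul_comm, Matrix.trace_add, Matrix.trace_sub, Matrix.trace_smul,
    hd0.trace_mul_left t1, hd0.trace_mul_left t2, hx0.trace_mul_left t1, hx0.trace_mul_left t2, t4,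
    (tracelessAt_site c hA).trace_mul_left t3, smul_eq_mul]
  ring

/-- The weight that returns to an inner qubit of a block. -/
theorem re_trace_stay_le {α β γ : ℝ} {a b c d : Fin n} (hab : a ≠ b) (hac : a ≠ c)
    (hbc : b ≠ c) {E₁ M E₂ : Op n} (h₁ : PairFactor α a b E₁)
    (hM : ChainFactor β a b c d M) (h₂ : PairFactor γ a b E₂) {A : Matrix (Fin 2) (Fin 2) ℂ}
    (hA : A.trace = 0) (hA2 : A * A = 1) (hAH : Aᴴ = A) :
    (E₂ * M * E₁ * site b A * (E₂ * M * E₁)ᴴ * site b A).trace.re ≤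
      (Real.cos α ^ 2 * Real.cos γ ^ 2 * Real.cos β ^ 2 + Real.sin α ^ 2 * Real.sin γ ^ 2 +
        2 * |Real.sin α * Real.cos α * Real.sin γ * Real.cos γ| * Real.cos β ^ 2) * 2 ^ n := by
  rw [trace_layers, h₁.symm.conj_site, h₂.symm.conj_site' hab.symm]
  obtain ⟨L, hL, R, hR, ⟨hLb, hLc, -⟩, ⟨-, hRb, hRc⟩, -, rfl⟩ := hM
  have hQ := mul_mem hL hR
  have hQb := mul_mem hLb hRb
  have hQc := mul_mem hLc hRc
  generalize L * R = Q at hQ hQb hQc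
  have hga := swapRot_mem_triv hab hac β
  have hM : swapRot β b c * Q ∈ unitary (Op n) := mul_mem (swapRot_mem_unitary β b c) hQ
  have ha0 := tracelessAt_site a hA
  have hb0 := tracelessAt_site b hA
  have hxa := tracelessAt_swapBracket_right b a A
  have hxb := tracelessAt_swapBracket_left b a A
  have t1 : swapRot β b c * Q * site a A * (swapRot β b c * Q)ᴴ ∈ triv b := by
    rw [conj_mul, conj_eq_self (swapRot_mem_unitary β b c)]
    · exact mul_mem (mul_mem hQb (site_mem_triv hab A)) (conjTranspose_mem_triv hQb)
    · exact (commute_swapRot hbc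
        (mul_mem (mul_mem hQb (site_mem_triv hab A)) (conjTranspose_mem_triv hQb))
        (mul_mem (mul_mem hQc (site_mem_triv hac A)) (conjTranspose_mem_triv hQc)) β).symm
  have t2' : swapRot β b c * Q * site b A * (swapRot β b c * Q)ᴴ =
      swapRot β b c * site b A * (swapRot β b c)ᴴ := by
    rw [conj_mul, conj_eq_self hQ (mem_triv.1 hQb A)]
  have t2 : swapRot β b c * Q * site b A * (swapRot β b c * Q)ᴴ ∈ triv a := by
    rw [t2']
    exact mul_mem (mul_mem hga (site_mem_triv hab.symm A)) (conjTranspose_mem_triv hga)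
  have t3 : (swapRot β b c * Q * site b A * (swapRot β b c * Q)ᴴ * site b A).trace =
      (Real.cos β : ℂ) ^ 2 * 2 ^ n := by
    rw [t2', trace_swapRot_conj_site_mul_self hbc β hA hA2]
  have t4 : (swapRot β b c * Q * swapBracket b a A * (swapRot β b c * Q)ᴴ * site a A).trace = 0 := by
    rw [trace_conj_mul]
    refine hxb _ ?_
    rw [conj_mul', conj_eq_self' (swapRot_mem_unitary β b c)
      (commute_swapRot hbc (site_mem_triv hab A) (site_mem_triv hac A) β).symm]
    exact mul_mem (mul_mem (conjTranspose_mem_triv hQb) (site_mem_triv hab A)) hQb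
  have t5 : (swapRot β b c * Q * swapBracket b a A * (swapRot β b c * Q)ᴴ * site b A).trace = 0 := by
    rw [trace_conj_mul]
    refine hxa _ ?_
    -- `Q` may act on `a`, but the gate spreads A_b only over `b` and `c`, where `Q` is trivial, so
    -- `Q` drops out.
    have e : (swapRot β b c)ᴴ * site b A * swapRot β b c ∈ triv a :=
      mul_mem (mul_mem (conjTranspose_mem_triv hga) (site_mem_triv hab.symm A)) hga
    rw [conj_mul', conj_eq_self' hQ]
    · exact e
    · rw [PairFactor.conj_site' (t := β) (E := swapRot β b c) hbc
        ⟨1, one_mem _, one_mem _, one_mem _, (mul_one _).symm⟩ A]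
      exact ((((mem_triv.1 hQb A).smul_right _).add_right
        ((mem_triv.1 hQc A).smul_right _)).sub_right
        ((commute_swapBracket hbc hQb hQc A).smul_right _))
  have hxc : swapBracket b a A ∈ triv c := swapBracket_mem_triv hbc.symm hac.symm A
  have t6 : (swapRot β b c * Q * swapBracket b a A * (swapRot β b c * Q)ᴴ *
      swapBracket b a A).trace = (Real.cos β : ℂ) ^ 2 *
        (Q * swapBracket b a A * Qᴴ * swapBracket b a A).trace := by
    rw [conj_mul, trace_swapRot_conj_mul hbc β
      (mul_mem (mul_mem hQc hxc) (conjTranspose_mem_triv hQc)) hxc hxb]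
  have t7 : |(Q * swapBracket b a A * Qᴴ * swapBracket b a A).trace.re| ≤ 2 * 2 ^ n := by
    refine (abs_re_trace_conj_mul_le hQ _ _).trans_eq ?_
    rw [conjTranspose_swapBracket b a hAH, neg_mul, Matrix.trace_neg,
      trace_swapBracket_mul_self hab.symm hA hA2]
    have h : (-(-(2 * 2 ^ n : ℂ))).re = 2 * 2 ^ n := by
      rw [neg_neg]
      exact_mod_cast Complex.ofReal_re (2 * 2 ^ n)
    rw [h]
    ring
  -- How the middle layer acts on `a` from the neighbouring side is unknown, so only the general
  -- unitary bound is used.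
  have t8 : (swapRot β b c * Q * site a A * (swapRot β b c * Q)ᴴ * site a A).trace.re ≤ 2 ^ n :=
    re_trace_conj_site_le hM a a hA2 hAH
  generalize swapRot β b c * Q = M at *
  simp only [mul_add, add_mul, mul_sub, mul_smul_comm, smul_mul_assoc, Matrix.trace_add,
    Matrix.trace_sub, Matrix.trace_smul, hb0.trace_mul_left t1, ha0.trace_mul_left t2,
    hxb.trace_mul_left t1, hxa.trace_mul_left t2, t3, t4, t5, t6, smul_eq_mul, mul_zero, add_zero,
    zero_add]
  generalize (M * site a A * Mᴴ * site a A).trace = z at *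
  generalize (Q * swapBracket b a A * Qᴴ * swapBracket b a A).trace = w at *
  have hI := Complex.I_mul_I
  generalize Real.cos α = x, Real.sin α = x', Real.cos β = y, Real.cos γ = u, Real.sin γ = u'
  -- The two factors i of the bracket terms multiply to -1, which makes all coefficients real.
  have e : (u : ℂ) ^ 2 * (x ^ 2 * (y ^ 2 * 2 ^ n)) + u' ^ 2 * (x' ^ 2 * z) -
      Complex.I * u' * u * (Complex.I * x' * x * (y ^ 2 * w)) =
      ((x ^ 2 * u ^ 2 * y ^ 2 * 2 ^ n : ℝ) : ℂ) + ((x' ^ 2 * u' ^ 2 : ℝ) : ℂ) * z +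
        ((x' * x * u' * u * y ^ 2 : ℝ) : ℂ) * w := by
    push_cast
    linear_combination (-(u' * u * x' * x * y ^ 2 * w) : ℂ) * hI
  rw [e, Complex.add_re, Complex.add_re, Complex.re_ofReal_mul, Complex.re_ofReal_mul,
    Complex.ofReal_re]
  have hw : x' * x * u' * u * y ^ 2 * w.re ≤ |x' * x * u' * u| * y ^ 2 * (2 * 2 ^ n) := by
    refine (le_abs_self _).trans ?_
    rw [abs_mul, abs_mul, abs_of_nonneg (sq_nonneg y)]
    exact mul_le_mul_of_nonneg_left t7 (by positivity)
  have hz : x' ^ 2 * u' ^ 2 * z.re ≤ x' ^ 2 * u' ^ 2 * 2 ^ n :=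
    mul_le_mul_of_nonneg_left t8 (by positivity)
  linarith

/-- With u = |cos α cos γ|, v = |sin α sin γ| and q = sin²β, the left side is (u + v)² - q(u² +
2uv). Here u + v ≤ 1, and the hypotheses give u² ≥ 1/4. -/
theorem stay_weight_le {α β γ : ℝ} (hα : 1 / 2 ≤ Real.cos α ^ 2) (hγ : 1 / 2 ≤ Real.cos γ ^ 2) :
    Real.cos α ^ 2 * Real.cos γ ^ 2 * Real.cos β ^ 2 + Real.sin α ^ 2 * Real.sin γ ^ 2 +
        2 * |Real.sin α * Real.cos α * Real.sin γ * Real.cos γ| * Real.cos β ^ 2 ≤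
      1 - Real.sin β ^ 2 / 4 := by
  have h1 := Real.sin_sq_add_cos_sq α
  have h2 := Real.sin_sq_add_cos_sq γ
  have h3 := Real.sin_sq_add_cos_sq β
  have hu : |Real.cos α * Real.cos γ| ^ 2 = Real.cos α ^ 2 * Real.cos γ ^ 2 := by
    rw [sq_abs, mul_pow]
  have hv : |Real.sin α * Real.sin γ| ^ 2 = Real.sin α ^ 2 * Real.sin γ ^ 2 := by
    rw [sq_abs, mul_pow]
  have huv : |Real.sin α * Real.cos α * Real.sin γ * Real.cos γ| =
      |Real.cos α * Real.cos γ| * |Real.sin α * Real.sin γ| := by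
    rw [← abs_mul]
    congr 1
    ring
  have hle : |Real.cos α * Real.cos γ| + |Real.sin α * Real.sin γ| ≤ 1 := by
    rw [abs_mul, abs_mul]
    -- AM–GM on each product, then sin² + cos² = 1 for both angles.
    nlinarith [sq_nonneg (|Real.cos α| - |Real.cos γ|), sq_nonneg (|Real.sin α| - |Real.sin γ|),
      sq_abs (Real.cos α), sq_abs (Real.cos γ), sq_abs (Real.sin α), sq_abs (Real.sin γ)]
  have hu4 : 1 / 4 ≤ |Real.cos α * Real.cos γ| ^ 2 := by
    rw [hu]
    nlinarith
  rw [huv, ← hu, ← hv]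
  have hu0 := abs_nonneg (Real.cos α * Real.cos γ)
  have hv0 := abs_nonneg (Real.sin α * Real.sin γ)
  generalize |Real.cos α * Real.cos γ| = u at *
  generalize |Real.sin α * Real.sin γ| = v at *
  have hq : Real.cos β ^ 2 = 1 - Real.sin β ^ 2 := by linarith
  rw [hq]
  have hq0 := sq_nonneg (Real.sin β)
  generalize Real.sin β ^ 2 = q at *
  have hsq : (u + v) ^ 2 ≤ 1 := by nlinarith
  have : q * (1 / 4) ≤ q * (u ^ 2 + 2 * u * v) :=
    mul_le_mul_of_nonneg_left (by nlinarith [mul_nonneg hu0 hv0]) hq0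
  nlinarith

theorem hop_weight_le {α β γ : ℝ} (hα : 1 / 2 ≤ Real.cos α ^ 2) (hγ : 1 / 2 ≤ Real.cos γ ^ 2) :
    Real.sin α ^ 2 * Real.sin β ^ 2 * Real.sin γ ^ 2 ≤ Real.sin β ^ 2 / 4 := by
  have h1 := Real.sin_sq_add_cos_sq α
  have h2 := Real.sin_sq_add_cos_sq γ
  have h : Real.sin α ^ 2 * Real.sin γ ^ 2 ≤ 1 / 2 * (1 / 2) :=
    mul_le_mul (by linarith) (by linarith) (sq_nonneg _) (by norm_num)
  nlinarith [sq_nonneg (Real.sin β)]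

/-- As long as the outer gates of a block stay close to the identity, the four overlaps of the
block do not exceed one half of their largest possible value. -/
theorem re_trace_block_le {α α' β γ γ' : ℝ} {a b c d : Fin n} (hab : a ≠ b) (hac : a ≠ c)
    (had : a ≠ d) (hbc : b ≠ c) (hbd : b ≠ d) (hcd : c ≠ d) {E₁ M E₂ : Op n}
    (h₁ : PairFactor α a b E₁) (h₁' : PairFactor α' c d E₁) (hM : ChainFactor β a b c d M)
    (h₂ : PairFactor γ a b E₂) (h₂' : PairFactor γ' c d E₂)
    (hα : 1 / 2 ≤ Real.cos α ^ 2) (hα' : 1 / 2 ≤ Real.cos α' ^ 2)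
    (hγ : 1 / 2 ≤ Real.cos γ ^ 2) (hγ' : 1 / 2 ≤ Real.cos γ' ^ 2)
    {A : Matrix (Fin 2) (Fin 2) ℂ} (hA : A.trace = 0) (hA2 : A * A = 1) (hAH : Aᴴ = A) :
    (E₂ * M * E₁ * site a A * (E₂ * M * E₁)ᴴ * site d A).trace.re +
        (E₂ * M * E₁ * site b A * (E₂ * M * E₁)ᴴ * site b A).trace.re +
        (E₂ * M * E₁ * site c A * (E₂ * M * E₁)ᴴ * site c A).trace.re +
        (E₂ * M * E₁ * site d A * (E₂ * M * E₁)ᴴ * site a A).trace.re ≤ 2 * 2 ^ n := by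
  have hre : ∀ x y z : ℝ, ((x : ℂ) ^ 2 * (y : ℂ) ^ 2 * (z : ℂ) ^ 2 * 2 ^ n).re =
      x ^ 2 * y ^ 2 * z ^ 2 * 2 ^ n := fun x y z => by
    have e : (x : ℂ) ^ 2 * (y : ℂ) ^ 2 * (z : ℂ) ^ 2 * 2 ^ n =
        ((x ^ 2 * y ^ 2 * z ^ 2 * 2 ^ n : ℝ) : ℂ) := by
      push_cast
      rfl
    rw [e, Complex.ofReal_re]
  have ha := trace_hop hab hac had hbc hbd hcd h₁ hM h₂' hA hA2
  -- The hypotheses are symmetric under reversing the chain, so d → a and c → c are mirror images of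
  -- a → d and b → b.
  have hd := trace_hop hcd.symm hbd.symm had.symm hbc.symm hac.symm hab.symm h₁'.symm hM.symm
    h₂.symm hA hA2
  have hb := re_trace_stay_le hab hac hbc h₁ hM h₂ hA hA2 hAH
  have hc := re_trace_stay_le hcd.symm hbd.symm hbc.symm h₁'.symm hM.symm h₂'.symm hA hA2 hAH
  rw [ha, hd, hre, hre]
  have hN : (0 : ℝ) ≤ 2 ^ n := by positivity
  have ka := mul_le_mul_of_nonneg_right (hop_weight_le (β := β) hα hγ') hN
  have kd := mul_le_mul_of_nonneg_right (hop_weight_le (β := β) hα' hγ) hN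
  have kb := mul_le_mul_of_nonneg_right (stay_weight_le (β := β) hα hγ) hN
  have kc := mul_le_mul_of_nonneg_right (stay_weight_le (β := β) hα' hγ') hN
  linarith

/-! ### Isolating one gate of a layer -/

theorem exists_prod_ofFn_eq {M : Type*} [Monoid M] {m : ℕ} (f : Fin m → M) (k : Fin m) :
    ∃ l r : List M, (∀ x ∈ l, ∃ i < k, f i = x) ∧ (∀ x ∈ r, ∃ i > k, f i = x) ∧
      (List.ofFn f).prod = l.prod * f k * r.prod := by
  refine ⟨(List.ofFn f).take k, (List.ofFn f).drop (k + 1), ?_, ?_, ?_⟩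
  · intro x hx
    obtain ⟨i, hi, rfl⟩ := List.mem_take_iff_getElem.1 hx
    have : i < k := by simpa using hi
    exact ⟨⟨i, this.trans k.isLt⟩, this, by simp⟩
  · intro x hx
    obtain ⟨i, hi, rfl⟩ := List.mem_drop_iff_getElem.1 hx
    have : k + 1 + i < m := by simpa [add_comm, add_left_comm, add_assoc] using hi
    exact ⟨⟨k + 1 + i, this⟩, by simp only [gt_iff_lt, Fin.lt_def]; omega, by simp⟩
  · have hk : (k : ℕ) < (List.ofFn f).length := by simp
    have h := List.take_append_drop k (List.ofFn f)
    rw [List.drop_eq_getElem_cons hk] at h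
    rw [mul_assoc]
    conv_lhs => rw [← h]
    simp

theorem pairFactor_evenLayer (t : Fin (n / 2) → ℝ) (k : Fin (n / 2)) {a b : Fin n}
    (ha : a.val = 2 * k.val) (hb : b.val = 2 * k.val + 1) :
    PairFactor (t k) a b (evenLayer n t) := by
  obtain ⟨l, r, hl, hr, h⟩ := exists_prod_ofFn_eq (fun j : Fin (n / 2) =>
    swapRot (t j) (⟨2 * j.val, by omega⟩ : Fin n) ⟨2 * j.val + 1, by omega⟩) k
  have hu : ∀ l' : List (Op n), (∀ x ∈ l', ∃ j, swapRot (t j) (⟨2 * j.val, by omega⟩ : Fin n)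
      ⟨2 * j.val + 1, by omega⟩ = x) → l'.prod ∈ unitary (Op n) := fun l' h' =>
    list_prod_mem fun x hx => by
      obtain ⟨j, rfl⟩ := h' x hx
      exact swapRot_mem_unitary _ _ _
  have ht : ∀ c : Fin n, c = a ∨ c = b → ∀ l' : List (Op n), (∀ x ∈ l', ∃ j, j ≠ k ∧
      swapRot (t j) (⟨2 * j.val, by omega⟩ : Fin n) ⟨2 * j.val + 1, by omega⟩ = x) →
      l'.prod ∈ triv c := fun c hc l' h' =>
    list_prod_mem fun x hx => by
      obtain ⟨j, hj, rfl⟩ := h' x hx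
      have hj' := Fin.val_ne_of_ne hj
      have hc' : c.val = a.val ∨ c.val = b.val := hc.imp (congrArg _) (congrArg _)
      refine swapRot_mem_triv ?_ ?_ _ <;>
      · rw [Ne, Fin.ext_iff]
        dsimp only
        omega
  have hl' := fun c hc => ht c hc l fun x hx => (hl x hx).imp fun j hj => ⟨hj.1.ne, hj.2⟩
  have hr' := fun c hc => ht c hc r fun x hx => (hr x hx).imp fun j hj => ⟨hj.1.ne', hj.2⟩
  have hab : a ≠ b := by rw [Ne, Fin.ext_iff]; omega
  have ea : a = ⟨2 * k.val, by omega⟩ := Fin.ext ha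
  have eb : b = ⟨2 * k.val + 1, by omega⟩ := Fin.ext hb
  refine ⟨l.prod * r.prod,
    mul_mem (hu l fun x hx => (hl x hx).imp fun j hj => hj.2)
      (hu r fun x hx => (hr x hx).imp fun j hj => hj.2),
    mul_mem (hl' a (Or.inl rfl)) (hr' a (Or.inl rfl)),
    mul_mem (hl' b (Or.inr rfl)) (hr' b (Or.inr rfl)), ?_⟩
  rw [evenLayer, h, ← ea, ← eb, ← mul_assoc,
    (commute_swapRot hab (hl' a (Or.inl rfl)) (hl' b (Or.inr rfl)) (t k)).eq]

/-- Gates of smaller index touch only qubits up to `a`, and gates of larger index only qubits from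
`d` on. They supply the two side factors. -/
theorem chainFactor_oddLayer (t : Fin ((n - 1) / 2) → ℝ) (k : Fin ((n - 1) / 2)) {a b c d : Fin n}
    (ha : a.val = 2 * k.val) (hb : b.val = 2 * k.val + 1) (hc : c.val = 2 * k.val + 2)
    (hd : d.val = 2 * k.val + 3) :
    ChainFactor (t k) a b c d (oddLayer n t) := by
  obtain ⟨l, r, hl, hr, h⟩ := exists_prod_ofFn_eq (fun j : Fin ((n - 1) / 2) =>
    swapRot (t j) (⟨2 * j.val + 1, by omega⟩ : Fin n) ⟨2 * j.val + 2, by omega⟩) k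
  have hl' : ∀ x : Fin n, 2 * k.val < x.val → l.prod ∈ triv x := fun x hx =>
    list_prod_mem fun y hy => by
      obtain ⟨j, hj, rfl⟩ := hl y hy
      have hj' := Fin.lt_def.1 hj
      refine swapRot_mem_triv ?_ ?_ _ <;>
      · rw [Ne, Fin.ext_iff]
        dsimp only
        omega
  have hr' : ∀ x : Fin n, x.val < 2 * k.val + 3 → r.prod ∈ triv x := fun x hx =>
    list_prod_mem fun y hy => by
      obtain ⟨j, hj, rfl⟩ := hr y hy
      have hj' := Fin.lt_def.1 hj
      refine swapRot_mem_triv ?_ ?_ _ <;>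
      · rw [Ne, Fin.ext_iff]
        dsimp only
        omega
  have hbc : b ≠ c := by rw [Ne, Fin.ext_iff]; omega
  have eb : b = ⟨2 * k.val + 1, by omega⟩ := Fin.ext hb
  have ec : c = ⟨2 * k.val + 2, by omega⟩ := Fin.ext hc
  refine ⟨l.prod, ?_, r.prod, ?_, ⟨hl' b (by omega), hl' c (by omega), hl' d (by omega)⟩,
    ⟨hr' a (by omega), hr' b (by omega), hr' c (by omega)⟩, ?_, ?_⟩
  · refine list_prod_mem fun y hy => ?_
    obtain ⟨j, hj, rfl⟩ := hl y hy
    exact swapRot_mem_unitary _ _ _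
  · refine list_prod_mem fun y hy => ?_
    obtain ⟨j, hj, rfl⟩ := hr y hy
    exact swapRot_mem_unitary _ _ _
  · refine Commute.list_prod_right _ _ fun y hy => ?_
    obtain ⟨j, hj, rfl⟩ := hr y hy
    have hj' := Fin.lt_def.1 hj
    refine commute_swapRot ?_ (hl' _ ?_) (hl' _ ?_) _
    · rw [Ne, Fin.ext_iff]
      dsimp only
      omega
    · dsimp only
      omega
    · dsimp only
      omega
  · rw [oddLayer, h, ← eb, ← ec, ← mul_assoc,
      (commute_swapRot hbc (hl' b (by omega)) (hl' c (by omega)) (t k)).eq]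

theorem evenLayer_mem_unitary (t : Fin (n / 2) → ℝ) : evenLayer n t ∈ unitary (Op n) := by
  refine list_prod_mem fun x hx => ?_
  obtain ⟨j, rfl⟩ := (List.mem_ofFn' _ _).1 hx
  exact swapRot_mem_unitary _ _ _

theorem oddLayer_mem_unitary (t : Fin ((n - 1) / 2) → ℝ) : oddLayer n t ∈ unitary (Op n) := by
  refine list_prod_mem fun x hx => ?_
  obtain ⟨j, rfl⟩ := (List.mem_ofFn' _ _).1 hx
  exact swapRot_mem_unitary _ _ _

theorem circuit_mem_unitary (θ : Params n) : circuit θ ∈ unitary (Op n) :=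
  mul_mem (mul_mem (evenLayer_mem_unitary _) (oddLayer_mem_unitary _)) (evenLayer_mem_unitary _)

/-! ### Stabilizer averages and the cost as a sum of overlaps -/

/-- The projection onto a single-qubit stabilizer state. -/
def stabProj (t : Fin 6) : Matrix (Fin 2) (Fin 2) ℂ := Matrix.vecMulVec (stab t) (star (stab t))

/-- The reflection `2 |φ⟩⟨φ| - 1` of a single-qubit stabilizer state `φ`. -/
def stabRefl (t : Fin 6) : Matrix (Fin 2) (Fin 2) ℂ := (2 : ℂ) • stabProj t - 1

theorem inv_sqrt_two_mul_self : (1 / (Real.sqrt 2 : ℂ)) * (1 / (Real.sqrt 2 : ℂ)) = 1 / 2 := by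
  rw [div_mul_div_comm, one_mul, ← Complex.ofReal_mul, Real.mul_self_sqrt (by norm_num)]
  norm_num

theorem stabProj_eq : stabProj =
    ![!![1, 0; 0, 0], !![0, 0; 0, 1], !![1 / 2, 1 / 2; 1 / 2, 1 / 2],
      !![1 / 2, -1 / 2; -1 / 2, 1 / 2], !![1 / 2, -Complex.I / 2; Complex.I / 2, 1 / 2],
      !![1 / 2, Complex.I / 2; -Complex.I / 2, 1 / 2]] := by
  have h := inv_sqrt_two_mul_self
  have hI := Complex.I_mul_I
  funext t
  ext i j
  fin_cases t <;> fin_cases i <;> fin_cases j <;>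
    simp [stabProj, stab, Matrix.vecMulVec_apply, Complex.conj_ofReal] <;>
    first
      | linear_combination h
      | linear_combination -h
      | linear_combination Complex.I * h
      | linear_combination -Complex.I * h
      | linear_combination h - (1 / (Real.sqrt 2 : ℂ)) * (1 / (Real.sqrt 2 : ℂ)) * hI

theorem stabProj_eq_add (t : Fin 6) : stabProj t = (1 / 2 : ℂ) • (1 + stabRefl t) := by
  rw [stabRefl]
  module

theorem trace_stabRefl (t : Fin 6) : (stabRefl t).trace = 0 := by
  rw [stabRefl, stabProj_eq, Matrix.trace_sub, Matrix.trace_smul, Matrix.trace_one]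
  fin_cases t <;> norm_num [Matrix.trace_fin_two]

theorem stabRefl_mul_self (t : Fin 6) : stabRefl t * stabRefl t = 1 := by
  have h : stabProj t * stabProj t = stabProj t := by
    have hI := Complex.I_mul_I
    rw [stabProj_eq]
    ext i j
    fin_cases t <;> fin_cases i <;> fin_cases j <;>
      simp [Matrix.mul_apply, Fin.sum_univ_two] <;>
      first
        | linear_combination (0 : ℂ) * hI
        | linear_combination (1 / 4 : ℂ) * hI
        | linear_combination (-1 / 4 : ℂ) * hI
  rw [stabRefl, mul_sub, sub_mul, smul_mul_assoc, mul_smul_comm, h]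
  simp only [one_mul, mul_one]
  module

theorem conjTranspose_stabRefl (t : Fin 6) : (stabRefl t)ᴴ = stabRefl t := by
  rw [stabRefl, stabProj, Matrix.conjTranspose_sub, Matrix.conjTranspose_smul,
    Matrix.conjTranspose_one, Matrix.conjTranspose_vecMulVec]
  simp

theorem sum_stabProj : ∑ t, stabProj t = (3 : ℂ) • (1 : Matrix (Fin 2) (Fin 2) ℂ) := by
  rw [stabProj_eq]
  ext i j
  fin_cases i <;> fin_cases j <;> simp [Fin.sum_univ_succ] <;> ring

theorem vecMulVec_prodState (s : Fin n → Fin 6) :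
    Matrix.vecMulVec (prodState s) (star (prodState s)) = tensorOp fun i => stabProj (s i) := by
  ext x y
  simp [Matrix.vecMulVec_apply, prodState, tensorOp_apply, stabProj, Finset.prod_mul_distrib]

/-- The sum factorises over the qubits; each qubit other than `i` contributes 3 times the identity.
-/
theorem sum_tensorOp_of_eq (i : Fin n) (t : Fin 6) :
    ∑ s : Fin n → Fin 6 with s i = t, tensorOp (fun k => stabProj (s k)) =
      (3 : ℂ) ^ (n - 1) • site i (stabProj t) := by
  have hs : (Finset.univ.filter fun s : Fin n → Fin 6 => s i = t) =
      Fintype.piFinset fun k => if k = i then {t} else Finset.univ := by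
    ext s
    simp only [Finset.mem_filter, Finset.mem_univ, true_and, Fintype.mem_piFinset]
    constructor
    · rintro rfl k
      split_ifs with h <;> simp [h]
    · intro h
      simpa using h i
  ext x y
  rw [hs]
  simp only [Matrix.sum_apply, tensorOp_apply]
  rw [← Finset.prod_univ_sum (fun k => if k = i then {t} else Finset.univ)
    fun k r => stabProj r (x k) (y k), Matrix.smul_apply, site_apply,
    ← Finset.mul_prod_erase _ _ (Finset.mem_univ i)]
  have h3 : ∀ k ∈ Finset.univ.erase i,
      ∑ r ∈ (if k = i then {t} else Finset.univ), stabProj r (x k) (y k) =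
        3 * (1 : Matrix (Fin 2) (Fin 2) ℂ) (x k) (y k) := by
    intro k hk
    rw [if_neg (Finset.ne_of_mem_erase hk), ← Matrix.sum_apply, sum_stabProj]
    simp
  rw [Finset.prod_congr rfl h3, Finset.prod_mul_distrib, Finset.prod_const,
    Finset.card_erase_of_mem (Finset.mem_univ i), Finset.card_univ, Fintype.card_fin]
  simp
  ring

theorem trace_partialBraket (i : Fin n) (φ : Fin 2 → ℂ) (M : Op n) :
    (partialBraket i φ M).trace = (site i (Matrix.vecMulVec φ (star φ)) * M).trace := by
  have hN : ∀ (a b : Fin 2) (x y : {k : Fin n // k ≠ i} → Fin 2),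
      site i (Matrix.vecMulVec φ (star φ)) ((Equiv.funSplitAt i (Fin 2)).symm (b, x))
        ((Equiv.funSplitAt i (Fin 2)).symm (a, y)) =
      if y = x then φ b * star (φ a) else 0 := by
    intro a b x y
    have hi : ∀ (c : Fin 2) z, (Equiv.funSplitAt i (Fin 2)).symm (c, z) i = c := by simp
    have hk : ∀ (c : Fin 2) z (k : Fin n) (h : k ≠ i),
        (Equiv.funSplitAt i (Fin 2)).symm (c, z) k = z ⟨k, h⟩ := by
      intro c z k h
      simp [h]
    rw [site_apply, hi, hi, Matrix.vecMulVec_apply, Pi.star_apply]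
    simp only [Matrix.one_apply, Finset.prod_ite_zero, Finset.prod_const_one, mul_ite, mul_one,
      mul_zero]
    refine if_congr ?_ rfl rfl
    constructor
    · intro h
      funext k
      have := h k (by simp [k.2])
      rwa [hk _ _ _ k.2, hk _ _ _ k.2, eq_comm] at this
    · rintro rfl k h
      rw [hk _ _ _ (Finset.ne_of_mem_erase h), hk _ _ _ (Finset.ne_of_mem_erase h)]
  rw [Matrix.trace, Matrix.trace, ← Equiv.sum_comp (Equiv.funSplitAt i (Fin 2)).symm,
    Fintype.sum_prod_type, Finset.sum_comm]
  refine Finset.sum_congr rfl fun x _ => ?_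
  simp only [Matrix.diag_apply, Matrix.mul_apply, partialBraket, Matrix.of_apply]
  rw [Finset.sum_comm]
  refine Finset.sum_congr rfl fun b _ => ?_
  rw [← Equiv.sum_comp (Equiv.funSplitAt i (Fin 2)).symm, Fintype.sum_prod_type]
  refine Finset.sum_congr rfl fun a _ => ?_
  simp only [hN, ite_mul, zero_mul, Finset.sum_ite_eq', Finset.mem_univ, if_true]
  ring

/-- Insert (1 + A)/2 twice; the cross terms vanish because A and its conjugate are traceless. -/
theorem trace_site_stabProj_mul {W : Op n} (hW : W ∈ unitary (Op n)) (i : Fin n) (t : Fin 6) :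
    (site i (stabProj t) * (W * site i (stabProj t) * Wᴴ)).trace =
      (1 / 4 : ℂ) * (2 ^ n + (site i (stabRefl t) * (W * site i (stabRefl t) * Wᴴ)).trace) := by
  have hW1 := mul_conjTranspose_self_of_mem_unitary hW
  have hW2 := conjTranspose_mul_self_of_mem_unitary hW
  have h0 : (site i (stabRefl t)).trace = 0 := by
    simpa using tracelessAt_site i (trace_stabRefl t) 1 (one_mem _)
  have h1 : (W * site i (stabRefl t) * Wᴴ).trace = 0 := by
    rw [Matrix.trace_mul_comm, ← mul_assoc, hW2, one_mul, h0]
  have h2 : site i (stabProj t) = (1 / 2 : ℂ) • (1 + site i (stabRefl t)) := by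
    rw [stabProj_eq_add, site_smul, site_add, site_one]
  rw [h2]
  simp only [mul_add, add_mul, mul_smul_comm, smul_mul_assoc, Matrix.trace_add, Matrix.trace_smul,
    mul_one, one_mul, hW1, h0, h1, Matrix.trace_one, smul_eq_mul]
  simp
  ring

/-- The normalised overlap of the evolved one-qubit stabilizer operator `t` on the qubit `i` with
the same operator on the qubit `k`. -/
def overlap (U : Op n) (i k : Fin n) (t : Fin 6) : ℝ :=
  (U * site i (stabRefl t) * Uᴴ * site k (stabRefl t)).trace.re / 2 ^ n

theorem cost_eq_sum_overlap {S : Finset (Fin (n / 4))} {π : Equiv.Perm (Fin n)}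
    (hπ : target S = permOp π) (θ : Params n) :
    cost S θ = 1 / 12 * ∑ i, ∑ t, (1 - overlap (circuit θ) i (π i) t) := by
  have hU := circuit_mem_unitary θ
  have hV : permOp π ∈ unitary (Op n) := by
    rw [Unitary.mem_iff, Matrix.star_eq_conjTranspose, conjTranspose_permOp, permOp_mul, permOp_mul,
      inv_mul_cancel, mul_inv_cancel, permOp_one]
    exact ⟨rfl, rfl⟩
  rw [cost, Finset.sum_comm, Finset.mul_sum, Finset.mul_sum]
  refine Finset.sum_congr rfl fun i _ => ?_
  generalize circuit θ = U at hU
  have hW : Uᴴ * permOp π ∈ unitary (Op n) := mul_mem (Unitary.star_mem hU) hV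
  have hsum : ∑ s : Fin n → Fin 6, (Matrix.trace (partialBraket i (stab (s i))
      (Uᴴ * target S * Matrix.vecMulVec (prodState s) (star (prodState s)) *
        (target S)ᴴ * U))) =
      ∑ t, (3 : ℂ) ^ (n - 1) * ((1 / 4 : ℂ) * (2 ^ n +
        (U * site i (stabRefl t) * Uᴴ * site (π i) (stabRefl t)).trace)) := by
    rw [← Finset.sum_fiberwise _ (fun s : Fin n → Fin 6 => s i)]
    refine Finset.sum_congr rfl fun t _ => ?_
    have h1 : ∀ s ∈ Finset.univ.filter (fun s : Fin n → Fin 6 => s i = t),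
        (Matrix.trace (partialBraket i (stab (s i))
          (Uᴴ * target S * Matrix.vecMulVec (prodState s) (star (prodState s)) *
            (target S)ᴴ * U))) =
        (site i (stabProj t) * (Uᴴ * permOp π * tensorOp (fun k => stabProj (s k)) *
          (Uᴴ * permOp π)ᴴ)).trace := by
      intro s hs
      rw [trace_partialBraket, (Finset.mem_filter.1 hs).2, vecMulVec_prodState, hπ, stabProj,
        Matrix.conjTranspose_mul, Matrix.conjTranspose_conjTranspose]
      simp only [mul_assoc]
    rw [Finset.sum_congr rfl h1, ← Matrix.trace_sum, ← Finset.mul_sum, ← Finset.sum_mul,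
      ← Finset.mul_sum, sum_tensorOp_of_eq]
    simp only [mul_smul_comm, smul_mul_assoc, Matrix.trace_smul, smul_eq_mul]
    rw [trace_site_stabProj_mul hW, conj_mul, permOp_mul_site_mul_conjTranspose, trace_conj_mul,
      Matrix.conjTranspose_conjTranspose]
  have hre := congrArg Complex.re hsum
  rw [Complex.re_sum] at hre
  rw [Finset.sum_sub_distrib, hre, Complex.re_sum]
  have hterm : ∀ t, ((3 : ℂ) ^ (n - 1) * ((1 / 4 : ℂ) * (2 ^ n +
      (U * site i (stabRefl t) * Uᴴ * site (π i) (stabRefl t)).trace))).re =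
      3 ^ (n - 1) / 4 * 2 ^ n * (1 + overlap U i (π i) t) := by
    intro t
    have e : ∀ z : ℂ, (3 : ℂ) ^ (n - 1) * ((1 / 4 : ℂ) * (2 ^ n + z)) =
        ((3 ^ (n - 1) / 4 : ℝ) : ℂ) * (((2 ^ n : ℝ) : ℂ) + z) := by
      intro z
      push_cast
      ring
    rw [e, Complex.re_ofReal_mul, Complex.add_re, Complex.ofReal_re, overlap]
    field_simp
  simp only [hterm, ← Finset.mul_sum, Finset.sum_add_distrib, Finset.sum_sub_distrib]
  have h3 : (3 : ℝ) ^ n = 3 * 3 ^ (n - 1) := by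
    rw [← pow_succ', Nat.sub_add_cancel (Fin.pos i)]
  have h6 : (6 : ℝ) ^ n = 3 * 3 ^ (n - 1) * 2 ^ n := by
    rw [← h3, ← mul_pow]
    norm_num
  simp [h6]
  field_simp
  ring

theorem overlap_le_one {U : Op n} (hU : U ∈ unitary (Op n)) (i k : Fin n) (t : Fin 6) :
    overlap U i k t ≤ 1 :=
  div_le_one_of_le₀
    (re_trace_conj_site_le hU i k (stabRefl_mul_self t) (conjTranspose_stabRefl t)) (by positivity)

/-- For a circuit that permutes the qubits, the overlaps are zero or one. -/
theorem overlap_smul_permOp {c : ℂ} (hc : c * star c = 1) (π : Equiv.Perm (Fin n)) (i k : Fin n)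
    (t : Fin 6) : overlap (c • permOp π) i k t = if π i = k then 1 else 0 := by
  have h : c • permOp π * site i (stabRefl t) * (c • permOp π)ᴴ = site (π i) (stabRefl t) := by
    rw [← permOp_mul_site_mul_conjTranspose, Matrix.conjTranspose_smul]
    simp only [smul_mul_assoc, mul_smul_comm, smul_smul]
    rw [mul_comm, hc, one_smul]
  rw [overlap, h]
  split_ifs with hk
  · have e : ((2 : ℂ) ^ n).re = 2 ^ n := by exact_mod_cast Complex.ofReal_re ((2 : ℝ) ^ n)
    rw [hk, site_mul, stabRefl_mul_self, site_one, Matrix.trace_one]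
    simp [e]
  · rw [tracelessAt_site _ (trace_stabRefl t) _ (site_mem_triv (Ne.symm hk) _)]
    simp

/-! ### Circuits that permute qubits -/

/-- The product of the transpositions of `a k` and `b k`, over those `k` in `l` that satisfy `p`. -/
def swapProd {ι α : Type*} [DecidableEq α] (l : List ι) (p : ι → Prop) [DecidablePred p]
    (a b : ι → α) : Equiv.Perm α :=
  (l.map fun k => if p k then Equiv.swap (a k) (b k) else 1).prod

section swapProd

variable {ι α : Type*} [DecidableEq α] {l : List ι} {p : ι → Prop} [DecidablePred p]
  {a b : ι → α}

theorem swapProd_cons (x : ι) :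
    swapProd (x :: l) p a b = (if p x then Equiv.swap (a x) (b x) else 1) * swapProd l p a b :=
  rfl

theorem swapProd_of_ne {y : α} (h : ∀ k ∈ l, p k → y ≠ a k ∧ y ≠ b k) : swapProd l p a b y = y := by
  induction l with
  | nil => rfl
  | cons x l ih =>
    rw [swapProd_cons, Equiv.Perm.mul_apply, ih fun k hk => h k (List.mem_cons_of_mem _ hk)]
    split_ifs with hx
    · have := h x List.mem_cons_self hx
      exact Equiv.swap_apply_of_ne_of_ne this.1 this.2
    · rfl

theorem swapProd_apply (hl : l.Nodup)
    (hab : ∀ i j, i ≠ j → a i ≠ a j ∧ a i ≠ b j ∧ b i ≠ b j) {k : ι} (hk : k ∈ l) (hp : p k) :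
    swapProd l p a b (a k) = b k ∧ swapProd l p a b (b k) = a k := by
  induction l with
  | nil => simp at hk
  | cons x l ih =>
    obtain ⟨hxl, hl⟩ := List.nodup_cons.1 hl
    simp only [swapProd_cons, Equiv.Perm.mul_apply]
    rcases eq_or_ne k x with rfl | hkx
    · have hne : ∀ j ∈ l, k ≠ j := fun j hj => fun h => hxl (h ▸ hj)
      rw [swapProd_of_ne fun j hj _ => ⟨(hab k j (hne j hj)).1, (hab k j (hne j hj)).2.1⟩,
        swapProd_of_ne fun j hj _ => ⟨(hab j k (hne j hj).symm).2.1.symm, (hab k j (hne j hj)).2.2⟩,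
        if_pos hp]
      exact ⟨Equiv.swap_apply_left _ _, Equiv.swap_apply_right _ _⟩
    · obtain ⟨h1, h2⟩ := ih hl ((List.mem_cons.1 hk).resolve_left hkx)
      rw [h1, h2]
      have e1 := hab k x hkx
      have e2 := hab x k hkx.symm
      split_ifs
      · exact ⟨Equiv.swap_apply_of_ne_of_ne e2.2.1.symm e1.2.2,
          Equiv.swap_apply_of_ne_of_ne e1.1 e1.2.1⟩
      · exact ⟨rfl, rfl⟩

end swapProd

/-- At angle π/2 a gate is i · SWAP and at angle 0 it is the identity; the phases collect into `c`.
-/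
theorem exists_prod_swapRot_eq {ι : Type*} (l : List ι) (p : ι → Prop) [DecidablePred p]
    (a b : ι → Fin n) :
    ∃ c : ℂ, c * star c = 1 ∧
      (l.map fun k => swapRot (if p k then Real.pi / 2 else 0) (a k) (b k)).prod =
        c • permOp (swapProd l p a b) := by
  induction l with
  | nil => exact ⟨1, by simp, by simp [swapProd, permOp_one]⟩
  | cons x l ih =>
    obtain ⟨c, hc, h⟩ := ih
    simp only [swapProd, List.map_cons, List.prod_cons] at h ⊢
    rw [h]
    split_ifs
    · refine ⟨Complex.I * c, ?_, ?_⟩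
      · rw [star_mul']
        simp only [Complex.star_def, Complex.conj_I] at hc ⊢
        linear_combination (-Complex.I * Complex.I) * hc - Complex.I_mul_I
      · rw [swapRot_pi_div_two, smul_mul_smul_comm, swap_eq_permOp, permOp_mul]
    · exact ⟨c, hc, by rw [swapRot_zero, one_mul, one_mul]⟩

/-- The permutation of the qubits that is performed by the target. -/
def blockPerm (B : Finset (Fin (n / 4))) : Equiv.Perm (Fin n) :=
  swapProd (B.sort (· ≤ ·)) (fun _ => True) (fun j => (⟨4 * j.val, by omega⟩ : Fin n))
    fun j => ⟨4 * j.val + 3, by omega⟩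

theorem target_eq_permOp (B : Finset (Fin (n / 4))) : target B = permOp (blockPerm B) := by
  rw [target, blockPerm, swapProd]
  induction B.sort (· ≤ ·) with
  | nil => simp [permOp_one]
  | cons x l ih =>
    rw [List.map_cons, List.prod_cons, ih, List.map_cons, List.prod_cons, if_pos trivial,
      swap_eq_permOp, permOp_mul]

theorem blockPerm_apply {B : Finset (Fin (n / 4))} {j : Fin (n / 4)} (hj : j ∈ B) :
    blockPerm B ⟨4 * j.val, by omega⟩ = ⟨4 * j.val + 3, by omega⟩ ∧
      blockPerm B ⟨4 * j.val + 3, by omega⟩ = ⟨4 * j.val, by omega⟩ := by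
  refine swapProd_apply (l := B.sort (· ≤ ·)) (p := fun _ => True)
    (a := fun j : Fin (n / 4) => (⟨4 * j.val, by omega⟩ : Fin n))
    (b := fun j => ⟨4 * j.val + 3, by omega⟩)
    (Finset.sort_nodup _ _) (fun i k hik => ?_) ((Finset.mem_sort _).2 hj) trivial
  have := Fin.val_ne_of_ne hik
  simp only [Ne, Fin.ext_iff]
  omega

theorem blockPerm_of_ne {B : Finset (Fin (n / 4))} {y : Fin n}
    (h : ∀ j ∈ B, y.val ≠ 4 * j.val ∧ y.val ≠ 4 * j.val + 3) : blockPerm B y = y :=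
  swapProd_of_ne fun j hj _ => by
    simpa only [Ne, Fin.ext_iff] using h j ((Finset.mem_sort _).1 hj)

theorem blockPerm_injective : Function.Injective (blockPerm (n := n)) := by
  have key : ∀ B B' : Finset (Fin (n / 4)), blockPerm B = blockPerm B' → B ⊆ B' := by
    intro B B' h j hj
    by_contra hj'
    have h1 := (blockPerm_apply hj).1
    rw [h, blockPerm_of_ne] at h1
    · simp at h1
    · intro k hk
      have : j ≠ k := fun e => hj' (e ▸ hk)
      have := Fin.val_ne_of_ne this
      dsimp only
      omega
  exact fun B B' h => (key B B' h).antisymm (key B' B h.symm)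

open scoped Classical in
/-- The parameters for which the circuit performs the exchanges in the blocks of `B`. -/
def swapParams (B : Finset (Fin (n / 4))) : Params n :=
  Sum.elim (fun k => if ∃ j ∈ B, k.val / 2 = j.val then Real.pi / 2 else 0)
    (Sum.elim (fun k => if ∃ j ∈ B, k.val = 2 * j.val then Real.pi / 2 else 0)
      fun k => if ∃ j ∈ B, k.val / 2 = j.val then Real.pi / 2 else 0)

theorem exists_circuit_swapParams (B : Finset (Fin (n / 4))) :
    ∃ c : ℂ, c * star c = 1 ∧ circuit (swapParams B) = c • permOp (blockPerm B) := by
  classical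
  set p : Fin (n / 2) → Prop := fun k => ∃ j ∈ B, k.val / 2 = j.val with hp
  set q : Fin ((n - 1) / 2) → Prop := fun k => ∃ j ∈ B, k.val = 2 * j.val with hq
  obtain ⟨c, hc, h⟩ := exists_prod_swapRot_eq (List.finRange (n / 2)) p
    (fun j : Fin (n / 2) => (⟨2 * j.val, by omega⟩ : Fin n)) fun j => ⟨2 * j.val + 1, by omega⟩
  obtain ⟨d, hd, h'⟩ := exists_prod_swapRot_eq (List.finRange ((n - 1) / 2)) q
    (fun j : Fin ((n - 1) / 2) => (⟨2 * j.val + 1, by omega⟩ : Fin n))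
    fun j => ⟨2 * j.val + 2, by omega⟩
  set e := swapProd (List.finRange (n / 2)) p
    (fun j : Fin (n / 2) => (⟨2 * j.val, by omega⟩ : Fin n)) fun j => ⟨2 * j.val + 1, by omega⟩
    with he
  set o := swapProd (List.finRange ((n - 1) / 2)) q
    (fun j : Fin ((n - 1) / 2) => (⟨2 * j.val + 1, by omega⟩ : Fin n))
    fun j => ⟨2 * j.val + 2, by omega⟩ with ho
  -- In each block of `B`, conjugating the transposition (1 2) by (0 1)(2 3) gives (0 3).
  have hperm : e * o * e = blockPerm B := by
    have e_apply : ∀ k : Fin (n / 2), p k →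
        e ⟨2 * k.val, by omega⟩ = ⟨2 * k.val + 1, by omega⟩ ∧
          e ⟨2 * k.val + 1, by omega⟩ = ⟨2 * k.val, by omega⟩ := fun k hk => by
      refine swapProd_apply (l := List.finRange (n / 2)) (p := p)
        (a := fun j : Fin (n / 2) => (⟨2 * j.val, by omega⟩ : Fin n))
        (b := fun j => ⟨2 * j.val + 1, by omega⟩) (List.nodup_finRange _) (fun i j hij => ?_)
        (List.mem_finRange _) hk
      have := Fin.val_ne_of_ne hij
      simp only [Ne, Fin.ext_iff]
      omega
    have o_apply : ∀ k : Fin ((n - 1) / 2), q k →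
        o ⟨2 * k.val + 1, by omega⟩ = ⟨2 * k.val + 2, by omega⟩ ∧
          o ⟨2 * k.val + 2, by omega⟩ = ⟨2 * k.val + 1, by omega⟩ := fun k hk => by
      refine swapProd_apply (l := List.finRange ((n - 1) / 2)) (p := q)
        (a := fun j : Fin ((n - 1) / 2) => (⟨2 * j.val + 1, by omega⟩ : Fin n))
        (b := fun j => ⟨2 * j.val + 2, by omega⟩) (List.nodup_finRange _) (fun i j hij => ?_)
        (List.mem_finRange _) hk
      have := Fin.val_ne_of_ne hij
      simp only [Ne, Fin.ext_iff]
      omega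
    have o_fix : ∀ y : Fin n, (∀ j ∈ B, y.val ≠ 4 * j.val + 1 ∧ y.val ≠ 4 * j.val + 2) →
        o y = y := fun y hy => swapProd_of_ne fun k _ hk => by
      obtain ⟨j, hj, hkj⟩ := hk
      have := hy j hj
      simp only [Ne, Fin.ext_iff]
      omega
    have e_fix : ∀ y : Fin n, (∀ j ∈ B, y.val / 4 ≠ j.val) → e y = y :=
      fun y hy => swapProd_of_ne fun k _ hk => by
        obtain ⟨j, hj, hkj⟩ := hk
        have := hy j hj
        simp only [Ne, Fin.ext_iff]
        omega
    refine Equiv.ext fun y => ?_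
    simp only [Equiv.Perm.mul_apply]
    by_cases hy : ∃ j ∈ B, y.val / 4 = j.val
    · obtain ⟨j, hj, hyj⟩ := hy
      have e0 := e_apply ⟨2 * j.val, by omega⟩ ⟨j, hj, by simp⟩
      have e1 := e_apply ⟨2 * j.val + 1, by omega⟩ ⟨j, hj, by dsimp only; omega⟩
      have o0 := o_apply ⟨2 * j.val, by omega⟩ ⟨j, hj, rfl⟩
      have o1 := o_fix ⟨4 * j.val, by omega⟩ fun i _ => by dsimp only; omega
      have o2 := o_fix ⟨4 * j.val + 3, by omega⟩ fun i _ => by dsimp only; omega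
      have b0 := blockPerm_apply hj
      have b1 := blockPerm_of_ne (B := B) (y := ⟨4 * j.val + 1, by omega⟩) fun i _ => by
        dsimp only; omega
      have b2 := blockPerm_of_ne (B := B) (y := ⟨4 * j.val + 2, by omega⟩) fun i _ => by
        dsimp only; omega
      have k0 : 2 * (2 * j.val) = 4 * j.val := by ring
      have k1 : 2 * (2 * j.val + 1) = 4 * j.val + 2 := by ring
      have k2 : 4 * j.val + 2 + 1 = 4 * j.val + 3 := rfl
      simp only [k0, k1, k2] at e0 e1 o0
      have hcases : y = ⟨4 * j.val, by omega⟩ ∨ y = ⟨4 * j.val + 1, by omega⟩ ∨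
          y = ⟨4 * j.val + 2, by omega⟩ ∨ y = ⟨4 * j.val + 3, by omega⟩ := by
        simp only [Fin.ext_iff]
        omega
      rcases hcases with hy | hy | hy | hy
      · rw [hy, e0.1, o0.1, e1.1, b0.1]
      · rw [hy, e0.2, o1, e0.1, b1]
      · rw [hy, e1.1, o2, e1.2, b2]
      · rw [hy, e1.2, o0.2, e0.2, b0.2]
    · push Not at hy
      rw [e_fix y hy, o_fix y fun j hj => by have := hy j hj; omega, e_fix y hy,
        blockPerm_of_ne fun j hj => by have := hy j hj; omega]
  have hE : evenLayer n (fun k => if p k then Real.pi / 2 else 0) = c • permOp e := by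
    rw [evenLayer, List.ofFn_eq_map, h]
  have hO : oddLayer n (fun k => if q k then Real.pi / 2 else 0) = d • permOp o := by
    rw [oddLayer, List.ofFn_eq_map, h']
  refine ⟨c * d * c, ?_, ?_⟩
  · simp only [star_mul']
    linear_combination (c * star c * (d * star d) + d * star d) * hc + hd
  · rw [← hperm, circuit]
    simp only [swapParams, Sum.elim_inl, Sum.elim_inr]
    rw [hE, hO, smul_mul_smul_comm, smul_mul_smul_comm, permOp_mul, permOp_mul]

theorem circuit_swapParams_ne_smul {B B' : Finset (Fin (n / 4))} (h : B ≠ B') (c : ℂ) :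
    circuit (swapParams B) ≠ c • circuit (swapParams B') := by
  obtain ⟨d, hd, e⟩ := exists_circuit_swapParams B
  obtain ⟨d', -, e'⟩ := exists_circuit_swapParams B'
  rw [e, e', smul_smul]
  refine fun heq => h (blockPerm_injective (smul_permOp_inj ?_ heq))
  rintro rfl
  simp at hd

/-! ### Upper and lower bounds on the cost -/

theorem cost_swapParams_sdiff_le (S T : Finset (Fin (n / 4))) :
    cost S (swapParams (S \ T)) ≤ T.card := by
  obtain ⟨c, hc, h⟩ := exists_circuit_swapParams (S \ T)
  rw [cost_eq_sum_overlap (target_eq_permOp S), h]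
  simp only [overlap_smul_permOp hc, Finset.sum_const, Finset.card_univ, Fintype.card_fin]
  -- Only the end qubits of blocks in `T` are misplaced: at most 2|T| qubits, each costing 6/12.
  have hsub : (Finset.univ.filter fun i => blockPerm (S \ T) i ≠ blockPerm S i) ⊆
      (T.image fun j => (⟨4 * j.val, by omega⟩ : Fin n)) ∪
        T.image fun j => (⟨4 * j.val + 3, by omega⟩ : Fin n) := by
    intro i hi
    by_contra hne
    refine (Finset.mem_filter.1 hi).2 ?_
    have hne' : ∀ j ∈ T, i.val ≠ 4 * j.val ∧ i.val ≠ 4 * j.val + 3 := by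
      intro j hj
      constructor
      · exact fun h' => hne (Finset.mem_union_left _ (Finset.mem_image.2 ⟨j, hj, Fin.ext h'.symm⟩))
      · exact fun h' => hne (Finset.mem_union_right _ (Finset.mem_image.2 ⟨j, hj, Fin.ext h'.symm⟩))
    by_cases hS : ∃ j ∈ S, i.val = 4 * j.val ∨ i.val = 4 * j.val + 3
    · obtain ⟨j, hj, hij⟩ := hS
      have hjT : j ∈ S \ T := Finset.mem_sdiff.2 ⟨hj, fun hjT => by have := hne' j hjT; omega⟩
      rcases hij with hij | hij
      · rw [show i = ⟨4 * j.val, by omega⟩ from Fin.ext hij, (blockPerm_apply hjT).1,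
          (blockPerm_apply hj).1]
      · rw [show i = ⟨4 * j.val + 3, by omega⟩ from Fin.ext hij, (blockPerm_apply hjT).2,
          (blockPerm_apply hj).2]
    · push Not at hS
      rw [blockPerm_of_ne hS, blockPerm_of_ne fun j hj => hS j (Finset.mem_sdiff.1 hj).1]
  have hcard : (Finset.univ.filter fun i => blockPerm (S \ T) i ≠ blockPerm S i).card ≤
      T.card + T.card :=
    (Finset.card_le_card hsub).trans ((Finset.card_union_le _ _).trans
      (add_le_add Finset.card_image_le Finset.card_image_le))
  have hterm : ∀ i, (6 : ℕ) • (1 - if blockPerm (S \ T) i = blockPerm S i then (1 : ℝ) else 0) =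
      6 * if blockPerm (S \ T) i ≠ blockPerm S i then 1 else 0 := by
    intro i
    by_cases hi : blockPerm (S \ T) i = blockPerm S i <;> simp [hi]
  simp only [hterm]
  rw [← Finset.mul_sum, Finset.sum_boole]
  have : ((Finset.univ.filter fun i => blockPerm (S \ T) i ≠ blockPerm S i).card : ℝ) ≤
      T.card + T.card := by exact_mod_cast hcard
  linarith

/-- For each of the six labels, a block of `T` loses at least 4 - 2 = 2, hence 6 · 2/12 = 1 in all.
Terms outside these blocks are nonnegative. Middle angles and the other blocks are unrestricted. -/
theorem card_le_cost {S T : Finset (Fin (n / 4))} (hT : T ⊆ S) {θ : Params n}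
    (h₃ : ∀ j ∈ T, ∀ k : Fin (n / 2), k.val / 2 = j.val → 1 / 2 ≤ Real.cos (θ (Sum.inl k)) ^ 2)
    (h₁ : ∀ j ∈ T, ∀ k : Fin (n / 2), k.val / 2 = j.val →
      1 / 2 ≤ Real.cos (θ (Sum.inr (Sum.inr k))) ^ 2) :
    (T.card : ℝ) ≤ cost S θ := by
  rw [cost_eq_sum_overlap (target_eq_permOp S)]
  have hU := circuit_mem_unitary θ
  have h0 : ∀ i t, 0 ≤ 1 - overlap (circuit θ) i (blockPerm S i) t := fun i t =>
    sub_nonneg.2 (overlap_le_one hU _ _ t)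
  have hinj : Set.InjOn (fun x : Fin (n / 4) × Fin 4 =>
      (⟨4 * x.1.val + x.2.val, by omega⟩ : Fin n)) ((T ×ˢ Finset.univ : Finset (Fin (n / 4) × Fin 4)) :
        Set (Fin (n / 4) × Fin 4)) := by
    rintro ⟨j, r⟩ - ⟨j', r'⟩ - hjr
    have := congrArg Fin.val hjr
    dsimp only at this
    ext <;> dsimp only <;> omega
  have hblock : ∀ j ∈ T, ∀ t, 2 ≤ ∑ r : Fin 4, (1 - overlap (circuit θ)
      (⟨4 * j.val + r.val, by omega⟩ : Fin n) (blockPerm S ⟨4 * j.val + r.val, by omega⟩) t) := by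
    intro j hj t
    have b0 := blockPerm_apply (hT hj)
    have b1 := blockPerm_of_ne (B := S) (y := ⟨4 * j.val + 1, by omega⟩) fun i _ => by
      dsimp only; omega
    have b2 := blockPerm_of_ne (B := S) (y := ⟨4 * j.val + 2, by omega⟩) fun i _ => by
      dsimp only; omega
    have k0 : (⟨2 * j.val, by omega⟩ : Fin (n / 2)).val / 2 = j.val := by dsimp only; omega
    have k1 : (⟨2 * j.val + 1, by omega⟩ : Fin (n / 2)).val / 2 = j.val := by dsimp only; omega
    have key := re_trace_block_le (n := n) (a := ⟨4 * j.val, by omega⟩)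
      (b := ⟨4 * j.val + 1, by omega⟩) (c := ⟨4 * j.val + 2, by omega⟩)
      (d := ⟨4 * j.val + 3, by omega⟩) (by simp) (by simp) (by simp) (by simp) (by simp) (by simp)
      (pairFactor_evenLayer (fun k => θ (Sum.inr (Sum.inr k))) ⟨2 * j.val, by omega⟩
        (by dsimp only; omega) (by dsimp only; omega))
      (pairFactor_evenLayer (fun k => θ (Sum.inr (Sum.inr k))) ⟨2 * j.val + 1, by omega⟩
        (by dsimp only; omega) (by dsimp only; omega))
      (chainFactor_oddLayer (fun k => θ (Sum.inr (Sum.inl k))) ⟨2 * j.val, by omega⟩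
        (by dsimp only; omega) (by dsimp only; omega) (by dsimp only; omega)
        (by dsimp only; omega))
      (pairFactor_evenLayer (fun k => θ (Sum.inl k)) ⟨2 * j.val, by omega⟩
        (by dsimp only; omega) (by dsimp only; omega))
      (pairFactor_evenLayer (fun k => θ (Sum.inl k)) ⟨2 * j.val + 1, by omega⟩
        (by dsimp only; omega) (by dsimp only; omega))
      (h₁ j hj _ k0) (h₁ j hj _ k1) (h₃ j hj _ k0) (h₃ j hj _ k1)
      (trace_stabRefl t) (stabRefl_mul_self t) (conjTranspose_stabRefl t)
    rw [← circuit] at key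
    have key' : overlap (circuit θ) ⟨4 * j.val, by omega⟩ ⟨4 * j.val + 3, by omega⟩ t +
        overlap (circuit θ) ⟨4 * j.val + 1, by omega⟩ ⟨4 * j.val + 1, by omega⟩ t +
        overlap (circuit θ) ⟨4 * j.val + 2, by omega⟩ ⟨4 * j.val + 2, by omega⟩ t +
        overlap (circuit θ) ⟨4 * j.val + 3, by omega⟩ ⟨4 * j.val, by omega⟩ t ≤ 2 := by
      simp only [overlap, ← add_div]
      rwa [div_le_iff₀ (by positivity)]
    simp only [Fin.sum_univ_four, Fin.val_zero, Fin.val_one, Fin.val_two, add_zero,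
      show ((3 : Fin 4) : ℕ) = 3 from rfl, b0.1, b0.2, b1, b2]
    linarith
  have hsum : 12 * (T.card : ℝ) ≤
      ∑ i, ∑ t, (1 - overlap (circuit θ) i (blockPerm S i) t) := by
    calc 12 * (T.card : ℝ) = ∑ j ∈ T, ∑ t : Fin 6, (2 : ℝ) := by
          simp
          ring
      _ ≤ ∑ j ∈ T, ∑ t : Fin 6, ∑ r : Fin 4, (1 - overlap (circuit θ)
            (⟨4 * j.val + r.val, by omega⟩ : Fin n)
            (blockPerm S ⟨4 * j.val + r.val, by omega⟩) t) :=
          Finset.sum_le_sum fun j hj => Finset.sum_le_sum fun t _ => hblock j hj t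
      _ = ∑ x ∈ T ×ˢ (Finset.univ : Finset (Fin 4)), ∑ t : Fin 6, (1 - overlap (circuit θ)
            (⟨4 * x.1.val + x.2.val, by omega⟩ : Fin n)
            (blockPerm S ⟨4 * x.1.val + x.2.val, by omega⟩) t) := by
          rw [Finset.sum_product]
          exact Finset.sum_congr rfl fun j _ => Finset.sum_comm
      _ = ∑ i ∈ (T ×ˢ Finset.univ).image fun x : Fin (n / 4) × Fin 4 =>
            (⟨4 * x.1.val + x.2.val, by omega⟩ : Fin n),
            ∑ t, (1 - overlap (circuit θ) i (blockPerm S i) t) := by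
          rw [Finset.sum_image hinj]
      _ ≤ _ := Finset.sum_le_sum_of_subset_of_nonneg (Finset.subset_univ _)
          fun i _ _ => Finset.sum_nonneg fun t _ => h0 i t
  linarith

theorem half_le_cos_sq {t : ℝ} (ht : |t| ≤ Real.pi / 4) : 1 / 2 ≤ Real.cos t ^ 2 := by
  rw [Real.cos_sq]
  obtain ⟨h1, h2⟩ := abs_le.1 ht
  have := Real.cos_nonneg_of_neg_pi_div_two_le_of_le (x := 2 * t) (by linarith) (by linarith)
  linarith

/-- The outer gates in blocks of `T` have angle 0 at the centre, so within distance π/4 they keep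
cos² ≥ 1/2. -/
theorem card_le_cost_of_norm_sub_lt {S T : Finset (Fin (n / 4))} (hT : T ⊆ S) {θ : Params n}
    (hθ : ‖θ - swapParams (S \ T)‖ < Real.pi / 4) : (T.card : ℝ) ≤ cost S θ := by
  have h : ∀ g : GateIndex n, swapParams (S \ T) g = 0 → 1 / 2 ≤ Real.cos (θ g) ^ 2 := by
    intro g hg
    have := norm_le_pi_norm (θ - swapParams (S \ T)) g
    rw [Pi.sub_apply, hg, sub_zero, Real.norm_eq_abs] at this
    exact half_le_cos_sq (this.trans hθ.le)
  have hnot : ∀ j ∈ T, ∀ k : Fin (n / 2), k.val / 2 = j.val →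
      ¬∃ i ∈ S \ T, k.val / 2 = i.val := by
    rintro j hj k hk ⟨i, hi, hki⟩
    have : i = j := Fin.ext (hki.symm.trans hk)
    exact (Finset.mem_sdiff.1 hi).2 (this ▸ hj)
  exact card_le_cost hT (fun j hj k hk => h _ (if_neg (hnot j hj k hk)))
    fun j hj k hk => h _ (if_neg (hnot j hj k hk))

end SwapAnsatz

end

/-! ### Assembling the local minima -/

theorem mainTheorem10 (n : ℕ) (S : Finset (Fin (n / 4))) :
    ∃ θ : Fin (2 ^ S.card - 1) → SwapAnsatz.Params n,
      (∀ x y, x ≠ y →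
        ∀ c : ℂ, SwapAnsatz.circuit (θ x) ≠ c • SwapAnsatz.circuit (θ y)) ∧
      (∃ m : ℝ, IsLeast (Set.range fun θ' : SwapAnsatz.Params n => SwapAnsatz.cost S θ') m ∧
        ∀ x, 1 + m ≤ SwapAnsatz.cost S (θ x)) ∧
      (∀ x, ∀ θ' : SwapAnsatz.Params n, ‖θ' - θ x‖ < Real.pi / 4 →
        SwapAnsatz.cost S (θ x) ≤ SwapAnsatz.cost S θ') := by
  -- Local minima are indexed by the nonempty set of blocks left unswapped; the empty set would be
  -- the global minimum.
  have hcard : (S.powerset.erase ∅).card = 2 ^ S.card - 1 := by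
    rw [Finset.card_erase_of_mem (Finset.empty_mem_powerset S), Finset.card_powerset]
  let T := (Finset.equivFinOfCardEq hcard).symm
  have hTS : ∀ x, (T x).1 ⊆ S := fun x =>
    Finset.mem_powerset.1 (Finset.mem_of_mem_erase (T x).2)
  have hT0 : ∀ x, (T x).1.Nonempty := fun x =>
    Finset.nonempty_iff_ne_empty.2 (Finset.ne_of_mem_erase (T x).2)
  refine ⟨fun x => SwapAnsatz.swapParams (S \ (T x).1), ?_, ⟨0, ⟨⟨SwapAnsatz.swapParams S, ?_⟩, ?_⟩,
    ?_⟩, ?_⟩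
  · intro x y hxy c
    refine SwapAnsatz.circuit_swapParams_ne_smul (fun h => hxy ?_) c
    have h' := congrArg (S \ ·) h
    simp only [Finset.sdiff_sdiff_eq_self (hTS _)] at h'
    exact T.injective (Subtype.ext h')
  · refine le_antisymm ?_ ?_
    · simpa using SwapAnsatz.cost_swapParams_sdiff_le S ∅
    -- For `T = ∅` the angle conditions are vacuous and the bound says that the cost is nonnegative.
    · simpa using SwapAnsatz.card_le_cost (Finset.empty_subset S)
        (θ := SwapAnsatz.swapParams S) (by simp) (by simp)
  · rintro _ ⟨θ', rfl⟩
    simpa using SwapAnsatz.card_le_cost (Finset.empty_subset S) (θ := θ') (by simp) (by simp)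
  · intro x
    have h1 : (1 : ℝ) ≤ (T x).1.card := by exact_mod_cast (hT0 x).card_pos
    have h2 := SwapAnsatz.card_le_cost_of_norm_sub_lt (hTS x)
      (θ := SwapAnsatz.swapParams (S \ (T x).1)) (by simp [Real.pi_pos])
    rw [add_zero]
    exact h1.trans h2
  · intro x θ' hθ'
    exact (SwapAnsatz.cost_swapParams_sdiff_le S _).trans
      (SwapAnsatz.card_le_cost_of_norm_sub_lt (hTS x) hθ')
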